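/- There is a function $C_0:\mathbb N\to\mathbb R$ with the following property. For all real $\alpha>0$ and $0<\varepsilon<1$ there are constants $c,K>0$, depending only on $\alpha$ and $\varepsilon$, such that the following holds. Let $p$ be a prime and let $\phi\in\mathbb F_p[x]$ be irreducible over $\mathbb F_p$; put $C_\phi=C_0(\deg\phi)$, a constant that depends only on the degree of $\phi$. Let $n$ be a natural number with $$C_\phi\le p\le n^{(1-\varepsilon)/2}.$$ Let $\xi$ be a random variable with values in $\mathbb F_p$ that is $\alpha$-balanced, i.e. $\max_{a\in\mathbb F_p}\mathbb P(\xi=a)\le 1-\alpha$, and let $M$ be a random $n\times n$ matrix over $\mathbb F_p$ whose entries are independent copies of $\xi$. Then $$\Bigl|\,\mathbb P\bigl(\phi(x)\mid\det(M-x)\bigr)-\Bigl[1-\prod_{i=1}^{\infty}\bigl(1-p^{-i\deg\phi}\bigr)\Bigr]\Bigr|\;\le\;K\exp\bigl(-c\,n^{1-\varepsilon}/p^{2}\bigr).$$ -/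

import Mathlib

open MeasureTheory ProbabilityTheory Polynomial

/-- A random variable `ξ` with values in `𝔽_p` is `α`-balanced if no value is taken with
probability more than `1 - α`, that is, `max_a ℙ(ξ = a) ≤ 1 - α`. -/
def IsBalanced {p : ℕ} {Ω : Type*} [MeasurableSpace Ω] (α : ℝ) (ξ : Ω → ZMod p)
    (P : Measure Ω) : Prop :=
  ∀ a : ZMod p, P.real {ω | ξ ω = a} ≤ 1 - α

/-- The entries of the random `n × n` matrix `M` (on the probability space `(Ω, P)`) are
independent copies of the random variable `ξ` (on the probability space `(Ω', P')`).
Mathlib's sigma-algebra on `ZMod p` is the discrete one. -/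
structure HasIIDEntries {p n : ℕ} {Ω Ω' : Type*} [MeasurableSpace Ω] [MeasurableSpace Ω']
    (M : Ω → Matrix (Fin n) (Fin n) (ZMod p)) (P : Measure Ω)
    (ξ : Ω' → ZMod p) (P' : Measure Ω') : Prop where
  indep : iIndepFun (fun (ij : Fin n × Fin n) ω => M ω ij.1 ij.2) P
  identDistrib : ∀ i j, IdentDistrib (fun ω => M ω i j) ξ P P'

/-- The characteristic polynomial `det (M - x)`, with the sign convention that the leading
coefficient is `(-1) ^ n`. -/
noncomputable def detSubX {p n : ℕ} (M : Matrix (Fin n) (Fin n) (ZMod p)) : (ZMod p)[X] :=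
  (M.map (C : ZMod p → (ZMod p)[X]) - (X : (ZMod p)[X]) • 1).det

/-! Let λ be the class of x in the field E = 𝔽_p[x]/φ, with q = |E| = p^d. Then φ divides det(M - x)
exactly when M - λ is singular over E. Expose the columns of M - λ one at a time. Given that the
first l are independent with span W, a uniform vector of E^n would fall in W with probability
q^{-(n-l)}, and multiplying the complementary probabilities gives the main term. The difficulty is
that a column ranges only over a translate of 𝔽_p^n and its entries need not be uniform.

Fourier analysis on E^n/W shows when this does no harm (`abs_mass_column_mem_sub_le`). Fix a
nontrivial additive character χ of E. Characters of E^n/W have the form y ↦ χ(w·y) with w orthogonal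
to the exposed columns, so w is a left eigenvector on them. Each coordinate with χ(w_i) ≠ 1
contributes a factor at most exp(-α/p²) (`IsWeight.norm_charFun_le`). Equidistribution can thus fail
only if some eigenvector w ≠ 0 has fewer than r such coordinates.

A union bound excludes these w (`mass_exists_isSparseEigenvector_le`). Off a small set S, the
coordinates of w lie in an 𝔽_p-subspace B which they span robustly (`exists_robust_span`). There are
about |B|^n such w, while each column equation has probability about b/|B|, where b = 1 - α:
robustness gives 1/|B|, and a coordinate outside B gives b. Powers of |B| nearly cancel, and b^{n-m}
beats the remaining entropy. Multiplying w by a power of λ ensures that a coordinate outside B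
exists (`IsSparseEigenvector.exists_ne_one`).

The equidistribution estimate is used for the last m = ⌈n^{1-ε/2}⌉ columns, with r = m + 1. For the
earlier ones the codimension is at least m, and the cruder bound b^m of `mass_sub_mem_le` suffices.
-/

/-! ### Finite probability with weights -/

/-- A probability weight on a finite type. -/
structure IsWeight {γ : Type*} [Fintype γ] (ν : γ → ℝ) : Prop where
  nonneg : ∀ x, 0 ≤ ν x
  sum_eq_one : ∑ x, ν x = 1

/-- The weight of independent coordinates, each with weight `μ`. -/
def prodWeight {ι β : Type*} [Fintype ι] (μ : β → ℝ) (x : ι → β) : ℝ := ∏ i, μ (x i)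

open Classical in
/-- The total weight of the points that satisfy `Q`. -/
noncomputable def mass {γ : Type*} [Fintype γ] (ν : γ → ℝ) (Q : γ → Prop) : ℝ :=
  ∑ x, if Q x then ν x else 0

section Mass

variable {γ : Type*} [Fintype γ] {ν : γ → ℝ}

theorem mass_eq_sum (Q : γ → Prop) [DecidablePred Q] :
    mass ν Q = ∑ x, ν x * (if Q x then 1 else 0) := by
  unfold mass
  refine Finset.sum_congr rfl fun x _ => ?_
  by_cases h : Q x <;> simp [h]

theorem IsWeight.mass_nonneg (hν : IsWeight ν) (Q : γ → Prop) : 0 ≤ mass ν Q :=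
  Finset.sum_nonneg fun x _ => by split_ifs <;> simp [hν.nonneg]

theorem IsWeight.mass_mono (hν : IsWeight ν) {Q R : γ → Prop} (h : ∀ x, Q x → R x) :
    mass ν Q ≤ mass ν R := by
  refine Finset.sum_le_sum fun x _ => ?_
  by_cases hQ : Q x
  · simp [hQ, h x hQ]
  · simp only [hQ, if_false]
    split_ifs <;> simp [hν.nonneg]

theorem mass_true (hν : IsWeight ν) : mass ν (fun _ => True) = 1 := by
  simp [mass, hν.sum_eq_one]

theorem mass_false : mass ν (fun _ => False) = 0 := by
  simp [mass]

theorem IsWeight.mass_le_one (hν : IsWeight ν) (Q : γ → Prop) : mass ν Q ≤ 1 :=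
  (hν.mass_mono fun _ _ => trivial).trans_eq (mass_true hν)

theorem mass_compl (hν : IsWeight ν) (Q : γ → Prop) : mass ν (fun x => ¬ Q x) = 1 - mass ν Q := by
  rw [← hν.sum_eq_one, eq_sub_iff_add_eq, mass, mass, ← Finset.sum_add_distrib]
  refine Finset.sum_congr rfl fun x _ => ?_
  by_cases h : Q x <;> simp [h]

theorem mass_add_mass_and_not (Q R : γ → Prop) :
    mass ν (fun x => Q x ∧ R x) + mass ν (fun x => Q x ∧ ¬ R x) = mass ν Q := by
  rw [mass, mass, mass, ← Finset.sum_add_distrib]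
  refine Finset.sum_congr rfl fun x _ => ?_
  by_cases h : Q x <;> by_cases h' : R x <;> simp [h, h']

theorem IsWeight.mass_exists_le (hν : IsWeight ν) {κ : Type*} [Fintype κ] (Q : κ → γ → Prop) :
    mass ν (fun x => ∃ i, Q i x) ≤ ∑ i, mass ν (Q i) := by
  classical
  unfold mass
  rw [Finset.sum_comm]
  refine Finset.sum_le_sum fun x _ => ?_
  split_ifs with h
  · obtain ⟨i, hi⟩ := h
    calc ν x = if Q i x then ν x else 0 := by simp [hi]
      _ ≤ _ := Finset.single_le_sum (f := fun i => if Q i x then ν x else 0)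
          (fun j _ => by split_ifs <;> simp [hν.nonneg]) (Finset.mem_univ i)
  · exact Finset.sum_nonneg fun j _ => by split_ifs <;> simp [hν.nonneg]

theorem IsWeight.mass_or_le (hν : IsWeight ν) (Q R : γ → Prop) :
    mass ν (fun x => Q x ∨ R x) ≤ mass ν Q + mass ν R := by
  rw [mass, mass, mass, ← Finset.sum_add_distrib]
  refine Finset.sum_le_sum fun x _ => ?_
  have := hν.nonneg x
  by_cases h : Q x <;> by_cases h' : R x <;> simp [h, h', this]

/-- An event of at most one point has mass at most the largest weight. -/
theorem mass_le_of_subsingleton {b : ℝ} (hb : ∀ x, ν x ≤ b) (hb0 : 0 ≤ b) {Q : γ → Prop}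
    (h : ∀ x y, Q x → Q y → x = y) : mass ν Q ≤ b := by
  classical
  unfold mass
  by_cases hQ : ∃ x, Q x
  · obtain ⟨x, hx⟩ := hQ
    rw [Finset.sum_eq_single x]
    · simpa [hx] using hb x
    · intro y _ hy
      exact if_neg fun hQy => hy (h _ _ hQy hx)
    · simp
  · push Not at hQ
    simp [hQ, hb0]

end Mass

section ProdWeight

variable {ι β : Type*} [Fintype ι] [Fintype β] {μ : β → ℝ}

theorem sum_prod_apply [DecidableEq ι] {R : Type*} [CommSemiring R] (f : ι → β → R) :
    ∑ x : ι → β, ∏ i, f i (x i) = ∏ i, ∑ b, f i b := by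
  rw [Finset.prod_univ_sum, Fintype.piFinset_univ]

theorem IsWeight.prodWeight [DecidableEq ι] (hμ : IsWeight μ) :
    IsWeight (prodWeight μ : (ι → β) → ℝ) where
  nonneg x := Finset.prod_nonneg fun i _ => hμ.nonneg _
  sum_eq_one := by
    unfold _root_.prodWeight
    rw [sum_prod_apply (fun _ => μ)]
    simp [hμ.sum_eq_one]

/-- Independent events in distinct coordinates. -/
theorem mass_prodWeight_forall [DecidableEq ι] (hμ : IsWeight μ) (J : Finset ι)
    (Q : ι → β → Prop) :
    mass (prodWeight μ) (fun x : ι → β => ∀ j ∈ J, Q j (x j)) = ∏ j ∈ J, mass μ (Q j) := by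
  classical
  have h1 : ∏ j ∈ J, mass μ (Q j) = ∏ j, ∑ b, if j ∈ J → Q j b then μ b else 0 := by
    rw [← Finset.prod_subset (Finset.subset_univ J)]
    · refine Finset.prod_congr rfl fun j hj => ?_
      simp [mass, hj]
    · intro j _ hj
      simp [hj, hμ.sum_eq_one]
  rw [h1, ← sum_prod_apply, mass]
  refine Finset.sum_congr rfl fun x _ => ?_
  rw [Finset.prod_ite_zero]
  simp [prodWeight]

/-- Replacing the coordinates off `S` by independent copies does not change expectations. -/
theorem sum_prodWeight_resample [DecidableEq ι] (hμ : IsWeight μ) (S : Finset ι)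
    (f : (ι → β) → ℝ) :
    ∑ x, prodWeight μ x * f x
      = ∑ x, prodWeight μ x * ∑ y, prodWeight μ y * f (S.piecewise x y) := by
  -- Take two independent copies x, y and swap their coordinates off S; this involution preserves
  -- the product weight.
  have hinv : Function.Involutive
      (fun q : (ι → β) × (ι → β) => (S.piecewise q.1 q.2, S.piecewise q.2 q.1)) := by
    rintro ⟨x, y⟩
    ext i <;> by_cases hi : i ∈ S <;> simp [hi]
  have hw : ∀ x y : ι → β, prodWeight μ (S.piecewise x y) * prodWeight μ (S.piecewise y x)
      = prodWeight μ x * prodWeight μ y := by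
    intro x y
    simp only [prodWeight, ← Finset.prod_mul_distrib]
    refine Finset.prod_congr rfl fun i _ => ?_
    by_cases hi : i ∈ S <;> simp [hi, mul_comm]
  calc ∑ x, prodWeight μ x * f x
      = ∑ q : (ι → β) × (ι → β), prodWeight μ q.1 * prodWeight μ q.2 * f q.1 := by
        rw [Fintype.sum_prod_type]
        refine Finset.sum_congr rfl fun x _ => ?_
        simp only [mul_right_comm _ _ (f x), ← Finset.mul_sum]
        rw [hμ.prodWeight.sum_eq_one, mul_one]
    _ = ∑ q : (ι → β) × (ι → β), prodWeight μ q.1 * prodWeight μ q.2 * f (S.piecewise q.1 q.2) := by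
        rw [← (Equiv.sum_comp hinv.toPerm)]
        refine Finset.sum_congr rfl fun q _ => ?_
        simp only [Function.Involutive.coe_toPerm]
        rw [hw]
    _ = _ := by
        rw [Fintype.sum_prod_type]
        refine Finset.sum_congr rfl fun x _ => ?_
        simp only [mul_assoc, ← Finset.mul_sum]

theorem mass_resample [DecidableEq ι] (hμ : IsWeight μ) (S : Finset ι) (Q : (ι → β) → Prop) :
    mass (prodWeight μ) Q
      = ∑ x, prodWeight μ x * mass (prodWeight μ) fun y => Q (S.piecewise x y) := by
  classical
  simp only [mass_eq_sum]
  exact sum_prodWeight_resample hμ S _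

/-- The same for a single coordinate. -/
theorem mass_update [DecidableEq ι] (hμ : IsWeight μ) (i : ι) (Q : (ι → β) → Prop) :
    mass (prodWeight μ) Q
      = ∑ x, prodWeight μ x * mass μ fun b => Q (Function.update x i b) := by
  rw [mass_resample hμ (Finset.univ.erase i)]
  refine Finset.sum_congr rfl fun x _ => ?_
  congr 1
  have h : ∀ y : ι → β, (Finset.univ.erase i).piecewise x y = Function.update x i (y i) := by
    intro y
    ext j
    by_cases hj : j = i
    · subst hj; simp
    · simp [hj]
  simp only [h]
  have := mass_prodWeight_forall hμ {i} (fun _ b => Q (Function.update x i b))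
  simpa using this

theorem IsWeight.sum_mul_le (hμ : IsWeight μ) {f : β → ℝ} {b : ℝ} (h : ∀ x, f x ≤ b) :
    ∑ x, μ x * f x ≤ b := by
  calc ∑ x, μ x * f x ≤ ∑ x, μ x * b :=
        Finset.sum_le_sum fun x _ => mul_le_mul_of_nonneg_left (h x) (hμ.nonneg x)
    _ = b := by rw [← Finset.sum_mul, hμ.sum_eq_one, one_mul]

end ProdWeight

/-! ### Characters -/

/-- Since the powers of ζ sum to zero, p = ∑ (1 - ζ^j), and each term has norm at most j‖1 - ζ‖, for
a total of at most (p²/2)‖1 - ζ‖. -/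
theorem norm_one_sub_ge {p : ℕ} {ζ : ℂ} (hp : 0 < p) (h1 : ζ ≠ 1) (hζ : ζ ^ p = 1) :
    2 / (p : ℝ) ≤ ‖1 - ζ‖ := by
  have hn : ‖ζ‖ = 1 := Complex.norm_eq_one_of_pow_eq_one hζ hp.ne'
  have hsum : ∑ j ∈ Finset.range p, ζ ^ j = 0 := by
    have := geom_sum_mul ζ p
    rw [hζ, sub_self] at this
    exact (mul_eq_zero.mp this).resolve_right (sub_ne_zero.mpr h1)
  have hj : ∀ j : ℕ, ‖1 - ζ ^ j‖ ≤ j * ‖1 - ζ‖ := by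
    intro j
    have : 1 - ζ ^ j = (∑ i ∈ Finset.range j, ζ ^ i) * (1 - ζ) := by
      have := geom_sum_mul ζ j
      linear_combination this
    rw [this, norm_mul]
    gcongr
    refine (norm_sum_le _ _).trans ?_
    simp [hn]
  have hp' : (p : ℂ) = ∑ j ∈ Finset.range p, (1 - ζ ^ j) := by
    rw [Finset.sum_sub_distrib, hsum]; simp
  have h2 : (p : ℝ) ≤ (∑ j ∈ Finset.range p, (j : ℝ)) * ‖1 - ζ‖ := by
    calc (p : ℝ) = ‖(p : ℂ)‖ := by simp
      _ ≤ ∑ j ∈ Finset.range p, ‖1 - ζ ^ j‖ := by rw [hp']; exact norm_sum_le _ _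
      _ ≤ ∑ j ∈ Finset.range p, j * ‖1 - ζ‖ := Finset.sum_le_sum fun j _ => hj j
      _ = _ := by rw [Finset.sum_mul]
  have h3 : ∑ j ∈ Finset.range p, (j : ℝ) ≤ (p : ℝ) ^ 2 / 2 := by
    have := Finset.sum_range_id_mul_two p
    have h4 : (∑ j ∈ Finset.range p, (j : ℝ)) * 2 = p * ((p - 1 : ℕ) : ℝ) := by
      rw [← Nat.cast_sum]
      exact_mod_cast this
    have h5 : ((p - 1 : ℕ) : ℝ) ≤ p := by exact_mod_cast Nat.sub_le _ _
    nlinarith [(Nat.cast_nonneg p : (0 : ℝ) ≤ p)]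
  have hp0 : (0 : ℝ) < p := by exact_mod_cast hp
  rw [div_le_iff₀ hp0]
  have h6 := h2.trans (mul_le_mul_of_nonneg_right h3 (norm_nonneg _))
  nlinarith

theorem AddChar.map_finset_sum {A R ι : Type*} [AddCommMonoid A] [CommMonoid R] (ψ : AddChar A R)
    (s : Finset ι) (f : ι → A) : ψ (∑ i ∈ s, f i) = ∏ i ∈ s, ψ (f i) := by
  classical
  induction s using Finset.induction_on with
  | empty => simp
  | insert a s ha ih => rw [Finset.sum_insert ha, Finset.prod_insert ha, AddChar.map_add_eq_mul, ih]

theorem AddChar.zmod_pow_eq_one {p : ℕ} (ψ : AddChar (ZMod p) ℂ) (a : ZMod p) : ψ a ^ p = 1 := by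
  rw [← AddChar.map_nsmul_eq_pow]; simp

theorem AddChar.zmod_norm [NeZero (p : ℕ)] (ψ : AddChar (ZMod p) ℂ) (a : ZMod p) : ‖ψ a‖ = 1 :=
  Complex.norm_eq_one_of_pow_eq_one (ψ.zmod_pow_eq_one a) (NeZero.ne p)

/-- The characteristic function of a balanced distribution on `ℤ/p`. -/
theorem IsWeight.norm_charFun_le {p : ℕ} [Fact p.Prime] {μ : ZMod p → ℝ} (hμ : IsWeight μ)
    {α : ℝ} (hα : ∀ a, μ a ≤ 1 - α) (ψ : AddChar (ZMod p) ℂ) (hψ : ψ ≠ 1) :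
    ‖∑ a, (μ a : ℂ) * ψ a‖ ≤ Real.exp (-(α / (p : ℝ) ^ 2)) := by
  have hp : p.Prime := Fact.out
  have hp0 : (0 : ℝ) < p := by exact_mod_cast hp.pos
  have hne : ∀ a : ZMod p, a ≠ 0 → ψ a ≠ 1 := by
    intro a ha h
    have hpr := AddChar.IsPrimitive.of_ne_one hψ
    exact ha ((hpr.zmod_char_eq_one_iff p a).mp h)
  have hre : ∀ a : ZMod p, a ≠ 0 → (ψ a).re ≤ 1 - 2 / (p : ℝ) ^ 2 := by
    intro a ha
    have h1 := norm_one_sub_ge hp.pos (hne a ha) (ψ.zmod_pow_eq_one a)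
    have h2 : ‖1 - ψ a‖ ^ 2 = 2 - 2 * (ψ a).re := by
      have h3 : ‖ψ a‖ ^ 2 = 1 := by rw [ψ.zmod_norm]; norm_num
      rw [← Complex.normSq_eq_norm_sq, Complex.normSq_apply] at h3 ⊢
      simp only [Complex.sub_re, Complex.one_re, Complex.sub_im, Complex.one_im]
      nlinarith
    have h4 : (2 / (p : ℝ)) ^ 2 ≤ ‖1 - ψ a‖ ^ 2 := by gcongr
    rw [h2, div_pow] at h4
    have : (2 : ℝ) ^ 2 / (p : ℝ) ^ 2 = 2 * (2 / (p : ℝ) ^ 2) := by ring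
    linarith
  -- Symmetrisation: two independent copies differ with probability at least α, and then Re ψ of the
  -- difference is at most 1 - 2/p².
  have hsq : ‖∑ a, (μ a : ℂ) * ψ a‖ ^ 2 = ∑ a, ∑ b, μ a * μ b * (ψ (a - b)).re := by
    have h1 : ((‖∑ a, (μ a : ℂ) * ψ a‖ ^ 2 : ℝ) : ℂ)
        = ∑ a, ∑ b, ((μ a * μ b : ℝ) : ℂ) * ψ (a - b) := by
      push_cast
      rw [← Complex.mul_conj', map_sum, Finset.sum_mul_sum]
      refine Finset.sum_congr rfl fun a _ => Finset.sum_congr rfl fun b _ => ?_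
      rw [map_mul, Complex.conj_ofReal, sub_eq_add_neg, AddChar.map_add_eq_mul,
        AddChar.map_neg_eq_conj]
      ring
    have h2 := congrArg Complex.re h1
    rw [Complex.ofReal_re] at h2
    rw [h2]
    simp [Complex.re_sum]
  have hle : ‖∑ a, (μ a : ℂ) * ψ a‖ ^ 2 ≤ 1 - 2 * (α / (p : ℝ) ^ 2) := by
    rw [hsq]
    have hterm : ∀ a b, μ a * μ b * (ψ (a - b)).re
        ≤ μ a * μ b * (1 - 2 / (p : ℝ) ^ 2)
          + (2 / (p : ℝ) ^ 2) * (if a = b then μ a * μ b else 0) := by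
      intro a b
      have hab : 0 ≤ μ a * μ b := mul_nonneg (hμ.nonneg _) (hμ.nonneg _)
      by_cases h : a = b
      · subst h
        simp only [sub_self, AddChar.map_zero_eq_one, Complex.one_re, if_true]
        apply le_of_eq; ring
      · rw [if_neg h, mul_zero, add_zero]
        exact mul_le_mul_of_nonneg_left (hre _ (sub_ne_zero.mpr h)) hab
    refine (Finset.sum_le_sum fun a _ => Finset.sum_le_sum fun b _ => hterm a b).trans ?_
    simp only [Finset.sum_add_distrib, ← Finset.mul_sum, ← Finset.sum_mul, hμ.sum_eq_one,
      Finset.sum_ite_eq, Finset.mem_univ, if_true]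
    have hdiag : ∑ a, μ a * μ a ≤ 1 - α := hμ.sum_mul_le hα
    have h2p : 0 ≤ 2 / (p : ℝ) ^ 2 := by positivity
    have := mul_le_mul_of_nonneg_left hdiag h2p
    have h3 : 2 * (α / (p : ℝ) ^ 2) = 2 / (p : ℝ) ^ 2 * α := by ring
    rw [h3]
    linarith
  have hexp : 1 - 2 * (α / (p : ℝ) ^ 2) ≤ Real.exp (-(α / (p : ℝ) ^ 2)) ^ 2 := by
    rw [← Real.exp_nat_mul]
    have := Real.add_one_le_exp (((2 : ℕ) : ℝ) * -(α / (p : ℝ) ^ 2))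
    push_cast at this ⊢
    linarith
  exact le_of_sq_le_sq (hle.trans hexp) (Real.exp_pos _).le

open Classical in
/-- A random combination of vectors is nearly uniform, unless some nontrivial character is
trivial at most of the vectors. -/
theorem abs_mass_sum_smul_sub_le {p : ℕ} [Fact p.Prime] {μ : ZMod p → ℝ} (hμ : IsWeight μ)
    {g : ℝ} (hg0 : 0 ≤ g) (hg1 : g ≤ 1)
    (hg : ∀ ψ : AddChar (ZMod p) ℂ, ψ ≠ 1 → ‖∑ a, (μ a : ℂ) * ψ a‖ ≤ g)
    {ι V : Type*} [Fintype ι] [DecidableEq ι] [AddCommGroup V] [Fintype V] [Module (ZMod p) V] (v : ι → V)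
    (r : ℕ) (h : ∀ ψ : AddChar V ℂ, ψ ≠ 1 → r ≤ (Finset.univ.filter fun i => ψ (v i) ≠ 1).card)
    (t : V) :
    |mass (prodWeight μ) (fun x : ι → ZMod p => ∑ i, x i • v i = t) - 1 / (Fintype.card V : ℝ)|
      ≤ g ^ r := by
  have hV : (0 : ℝ) < Fintype.card V := by exact_mod_cast Fintype.card_pos
  have hψx : ∀ (ψ : AddChar V ℂ) (x : ι → ZMod p), ψ (∑ i, x i • v i) = ∏ i, ψ (x i • v i) :=
    fun ψ x => ψ.map_finset_sum _ _
  -- the restriction of a character to a line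
  let res : AddChar V ℂ → V → AddChar (ZMod p) ℂ := fun ψ w =>
    ψ.compAddMonoidHom (((LinearMap.toSpanSingleton (ZMod p) V w)).toAddMonoidHom)
  have hres : ∀ ψ w a, res ψ w a = ψ (a • w) := fun ψ w a => rfl
  set c : AddChar V ℂ → ℂ := fun ψ => ∏ i, ∑ a, (μ a : ℂ) * ψ (a • v i) with hc
  -- Fourier inversion on V. The trivial character yields the main term 1/|V|; fewer than |V| others
  -- remain, each at most g^r before division by |V|.
  have hexp : ((mass (prodWeight μ) (fun x : ι → ZMod p => ∑ i, x i • v i = t) : ℝ) : ℂ)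
      * (Fintype.card V : ℂ) = ∑ ψ : AddChar V ℂ, ψ (-t) * c ψ := by
    rw [mass_eq_sum]
    push_cast
    rw [Finset.sum_mul]
    have h1 : ∀ x : ι → ZMod p, ((prodWeight μ x : ℝ) : ℂ)
        * (if ∑ i, x i • v i = t then 1 else 0) * (Fintype.card V : ℂ)
        = ∑ ψ : AddChar V ℂ, ψ (-t) * ∏ i, ((μ (x i) : ℂ) * ψ (x i • v i)) := by
      intro x
      have h2 := AddChar.sum_apply_eq_ite (∑ i, x i • v i - t)
      rw [sub_eq_zero] at h2
      have h3 : (if ∑ i, x i • v i = t then (1 : ℂ) else 0) * (Fintype.card V : ℂ)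
          = ∑ ψ : AddChar V ℂ, ψ (∑ i, x i • v i - t) := by
        rw [h2]; split_ifs <;> simp
      rw [mul_assoc, h3, Finset.mul_sum]
      refine Finset.sum_congr rfl fun ψ _ => ?_
      rw [sub_eq_add_neg, AddChar.map_add_eq_mul, hψx, Finset.prod_mul_distrib]
      simp only [prodWeight, Complex.ofReal_prod]
      ring
    simp only [apply_ite Complex.ofReal, Complex.ofReal_one, Complex.ofReal_zero]
    rw [Finset.sum_congr rfl fun x _ => h1 x, Finset.sum_comm]
    refine Finset.sum_congr rfl fun ψ _ => ?_
    rw [← Finset.mul_sum, sum_prod_apply (fun i a => (μ a : ℂ) * ψ (a • v i))]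
  have hnorm1 : ∀ (ψ : AddChar V ℂ) (y : V), ‖ψ y‖ = 1 := fun ψ y => AddChar.norm_apply ψ y
  have hcle : ∀ ψ : AddChar V ℂ, ψ ≠ 1 → ‖ψ (-t) * c ψ‖ ≤ g ^ r := by
    intro ψ hψ
    rw [norm_mul, hnorm1, one_mul, hc, norm_prod]
    have hfac : ∀ i, ‖∑ a, (μ a : ℂ) * ψ (a • v i)‖ ≤ if ψ (v i) ≠ 1 then g else 1 := by
      intro i
      split_ifs with hi
      · refine hg (res ψ (v i)) fun h1 => hi ?_
        have := DFunLike.congr_fun h1 (1 : ZMod p)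
        simpa [hres] using this
      · refine (norm_sum_le _ _).trans ?_
        simp only [norm_mul, hnorm1, mul_one, Complex.norm_real, Real.norm_eq_abs]
        rw [Finset.sum_congr rfl fun a _ => abs_of_nonneg (hμ.nonneg a), hμ.sum_eq_one]
    refine (Finset.prod_le_prod (fun i _ => norm_nonneg _) fun i _ => hfac i).trans ?_
    rw [Finset.prod_ite, Finset.prod_const, Finset.prod_const_one, mul_one]
    exact pow_le_pow_of_le_one hg0 hg1 (h ψ hψ)
  have hc1 : (1 : AddChar V ℂ) (-t) * c 1 = 1 := by
    simp only [hc, AddChar.one_apply, one_mul, mul_one]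
    have : ∑ a, (μ a : ℂ) = 1 := by exact_mod_cast hμ.sum_eq_one
    simp [this]
  rw [← Finset.add_sum_erase _ _ (Finset.mem_univ (1 : AddChar V ℂ)), hc1] at hexp
  have hdiff : (((mass (prodWeight μ) (fun x : ι → ZMod p => ∑ i, x i • v i = t)
      - 1 / (Fintype.card V : ℝ)) * Fintype.card V : ℝ) : ℂ)
      = ∑ ψ ∈ Finset.univ.erase (1 : AddChar V ℂ), ψ (-t) * c ψ := by
    rw [sub_mul, one_div, inv_mul_cancel₀ hV.ne']
    push_cast
    rw [hexp]; ring
  have hn := congrArg norm hdiff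
  rw [Complex.norm_real, Real.norm_eq_abs, abs_mul, abs_of_pos hV] at hn
  have hbound : ‖∑ ψ ∈ Finset.univ.erase (1 : AddChar V ℂ), ψ (-t) * c ψ‖
      ≤ Fintype.card V * g ^ r := by
    refine (norm_sum_le _ _).trans ?_
    refine (Finset.sum_le_sum fun ψ hψ => hcle ψ (Finset.ne_of_mem_erase hψ)).trans ?_
    rw [Finset.sum_const, nsmul_eq_mul]
    refine mul_le_mul_of_nonneg_right ?_ (pow_nonneg hg0 r)
    have := (Finset.card_erase_le (s := (Finset.univ : Finset (AddChar V ℂ))) (a := 1))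
    rw [Finset.card_univ, AddChar.card_eq] at this
    exact_mod_cast this
  rw [← hn, mul_comm] at hbound
  exact le_of_mul_le_mul_left hbound hV

/-! ### Robust spans and small-ball estimates -/

section Structure

variable {p : ℕ} [Fact p.Prime]

/-- The kernel of an additive character of a `ℤ/p`-module. -/
def AddChar.zmodKer {V : Type*} [AddCommGroup V] [Module (ZMod p) V] (ψ : AddChar V ℂ) :
    Submodule (ZMod p) V where
  carrier := {y | ψ y = 1}
  zero_mem' := by simp
  add_mem' := by
    intro a b ha hb
    simp only [Set.mem_ofPred_eq] at *
    rw [AddChar.map_add_eq_mul, ha, hb, one_mul]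
  smul_mem' := by
    intro c y hy
    simp only [Set.mem_ofPred_eq] at *
    rw [← ZMod.natCast_zmod_val c, Nat.cast_smul_eq_nsmul, AddChar.map_nsmul_eq_pow, hy, one_pow]

open Classical in
/-- Up to few exceptional coordinates, the coordinates of a vector span a space robustly: many of
them lie outside any given proper subspace. -/
theorem exists_robust_span {K V ι : Type*} [Field K] [AddCommGroup V] [Module K V]
    [FiniteDimensional K V] [Fintype ι] (w : ι → V) (r : ℕ) :
    ∃ (S : Finset ι) (B : Submodule K V), S.card ≤ r * Module.finrank K V ∧
      (∀ i, i ∉ S → w i ∈ B) ∧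
      ∀ H : Submodule K V, H < B → r ≤ (Finset.univ.filter fun i => i ∉ S ∧ w i ∉ H).card := by
  let B : Finset ι → Submodule K V := fun S => Submodule.span K (w '' {i | i ∉ S})
  -- Minimality against S = ∅ bounds |S|. If fewer than r coordinates missed some H < B, adding them
  -- to S would cost less than r and lower the dimension term by at least r.
  obtain ⟨S, -, hS⟩ := Finset.exists_min_image (Finset.univ : Finset (Finset ι))
    (fun S => S.card + r * Module.finrank K (B S)) ⟨∅, Finset.mem_univ _⟩
  refine ⟨S, B S, ?_, ?_, ?_⟩
  · have h0 := hS ∅ (Finset.mem_univ _)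
    have h1 : r * Module.finrank K (B ∅) ≤ r * Module.finrank K V :=
      Nat.mul_le_mul_left _ (Submodule.finrank_le _)
    simp only [Finset.card_empty] at h0
    omega
  · intro i hi
    exact Submodule.subset_span ⟨i, hi, rfl⟩
  · intro H hH
    set T := Finset.univ.filter fun i => i ∉ S ∧ w i ∉ H with hT
    have h1 := hS (S ∪ T) (Finset.mem_univ _)
    have h2 : B (S ∪ T) ≤ H := by
      refine Submodule.span_le.mpr ?_
      rintro _ ⟨i, hi, rfl⟩
      simp only [Set.mem_ofPred_eq, Finset.mem_union, not_or, hT, Finset.mem_filter,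
        Finset.mem_univ, true_and, not_and, not_not] at hi
      exact hi.2 hi.1
    have h3 : Module.finrank K (B (S ∪ T)) + 1 ≤ Module.finrank K (B S) :=
      Submodule.finrank_lt_finrank_of_lt (lt_of_le_of_lt h2 hH)
    have h4 := Nat.mul_le_mul_left r h3
    have h5 := Finset.card_union_le S T
    rw [mul_add, mul_one] at h4
    omega

variable {μ : ZMod p → ℝ}

open Classical in
/-- The probability that a random combination with a robust spanning part takes a given value. -/
theorem mass_sum_smul_eq_le (hμ : IsWeight μ) {b g : ℝ} (hb : ∀ a, μ a ≤ b)
    (hg0 : 0 ≤ g) (hg1 : g ≤ 1)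
    (hg : ∀ ψ : AddChar (ZMod p) ℂ, ψ ≠ 1 → ‖∑ a, (μ a : ℂ) * ψ a‖ ≤ g)
    {ι V : Type*} [Fintype ι] [DecidableEq ι] [AddCommGroup V] [Fintype V] [Module (ZMod p) V] (w : ι → V)
    (r : ℕ) (S : Finset ι) (B : Submodule (ZMod p) V) (hSB : ∀ i, i ∉ S → w i ∈ B)
    (hB : ∀ H : Submodule (ZMod p) V, H < B →
      r ≤ (Finset.univ.filter fun i => i ∉ S ∧ w i ∉ H).card)
    (i₀ : ι) (hi₀ : w i₀ ∉ B) (s : V) :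
    mass (prodWeight μ) (fun x : ι → ZMod p => ∑ i, x i • w i = s)
      ≤ b * (1 / (Fintype.card B : ℝ) + g ^ r) := by
  have hb0 : 0 ≤ b := (hμ.nonneg 0).trans (hb 0)
  have hC : (0 : ℝ) ≤ 1 / (Fintype.card B : ℝ) + g ^ r := by positivity
  -- the random combination modulo `B`
  have hmod : mass (prodWeight μ)
      (fun x : ι → ZMod p => ∑ i, (if i ∈ S then x i • w i else 0) - s ∈ B) ≤ b := by
    -- Vary only the coordinate `i₀`: as `w i₀` is nonzero modulo B, at most one value of it works.
    rw [mass_update hμ i₀]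
    refine hμ.prodWeight.sum_mul_le fun x => mass_le_of_subsingleton hb hb0 ?_
    intro a a' ha ha'
    have hi₀S : i₀ ∈ S := by
      by_contra h; exact hi₀ (hSB _ h)
    have h1 := B.sub_mem ha ha'
    rw [sub_sub_sub_cancel_right, ← Finset.sum_sub_distrib,
      Finset.sum_eq_single i₀] at h1
    · simp only [hi₀S, if_true, Function.update_self, ← sub_smul] at h1
      by_contra hne
      exact hi₀ ((B.smul_mem_iff (sub_ne_zero.mpr hne)).mp h1)
    · intro j _ hj
      simp [Function.update_of_ne hj]
    · simp
  -- The coordinates in S, among them `i₀`, must put the partial sum in s + B, which gives the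
  -- factor b. The fresh ones off S then have to hit one point of B, which gives 1/|B| + g^r.
  rw [mass_resample hμ S]
  have hinner : ∀ x : ι → ZMod p,
      mass (prodWeight μ) (fun y => ∑ i, S.piecewise x y i • w i = s)
        ≤ (if ∑ i, (if i ∈ S then x i • w i else 0) - s ∈ B then 1 else 0)
          * (1 / (Fintype.card B : ℝ) + g ^ r) := by
    intro x
    let v : ι → B := fun i => if h : i ∈ S then 0 else ⟨w i, hSB i h⟩
    have hv : ∀ y : ι → ZMod p, ∑ i, S.piecewise x y i • w i
        = ∑ i, (if i ∈ S then x i • w i else 0) + ((∑ i, y i • v i : B) : V) := by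
      intro y
      rw [AddSubmonoidClass.coe_finsetSum, ← Finset.sum_add_distrib]
      refine Finset.sum_congr rfl fun i _ => ?_
      by_cases hi : i ∈ S <;> simp [hi, v]
    simp only [hv]
    split_ifs with hx
    · rw [one_mul]
      let t : B := -⟨_, hx⟩
      have ht : ∀ y : ι → ZMod p, (∑ i, (if i ∈ S then x i • w i else 0)
          + ((∑ i, y i • v i : B) : V) = s) ↔ ∑ i, y i • v i = t := by
        intro y
        rw [← Subtype.coe_inj]
        simp only [t, Submodule.coe_neg]
        constructor
        · intro h; rw [← h]; abel
        · intro h; rw [h]; abel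
      simp only [ht]
      have := abs_mass_sum_smul_sub_le hμ hg0 hg1 hg v r (fun ψ hψ => ?_) t
      · linarith [(abs_le.mp this).2]
      -- The kernel of a nontrivial character of B is a proper subspace, so robustness supplies the
      -- r coordinates on which it is nontrivial.
      · have hlt : (ψ.zmodKer : Submodule (ZMod p) B).map B.subtype < B := by
          refine lt_of_le_of_ne (Submodule.map_subtype_le _ _) fun heq => hψ ?_
          refine DFunLike.ext _ _ fun y => ?_
          have hy : (y : V) ∈ (ψ.zmodKer : Submodule (ZMod p) B).map B.subtype := by
            rw [heq]; exact y.2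
          obtain ⟨z, hz, hzy⟩ := hy
          have : z = y := Subtype.ext hzy
          rw [← this]
          exact hz
        refine (hB _ hlt).trans (Finset.card_le_card ?_)
        intro i hi
        simp only [Finset.mem_filter, Finset.mem_univ, true_and] at hi ⊢
        intro h1
        refine hi.2 ⟨v i, h1, ?_⟩
        simp [v, hi.1]
    · rw [zero_mul]
      refine le_of_eq ?_
      rw [← mass_false (ν := (prodWeight μ : (ι → ZMod p) → ℝ))]
      congr 1
      ext y
      simp only [iff_false]
      intro h
      refine hx ?_
      rw [← h, sub_add_cancel_left]
      exact B.neg_mem (Subtype.mem _)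
  calc ∑ x, prodWeight μ x * mass (prodWeight μ) (fun y => ∑ i, S.piecewise x y i • w i = s)
      ≤ ∑ x, prodWeight μ x * ((if ∑ i, (if i ∈ S then x i • w i else 0) - s ∈ B then 1 else 0)
          * (1 / (Fintype.card B : ℝ) + g ^ r)) :=
        Finset.sum_le_sum fun x _ =>
          mul_le_mul_of_nonneg_left (hinner x) (hμ.prodWeight.nonneg x)
    _ = mass (prodWeight μ)
      (fun x : ι → ZMod p => ∑ i, (if i ∈ S then x i • w i else 0) - s ∈ B)
          * (1 / (Fintype.card B : ℝ) + g ^ r) := by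
        rw [mass_eq_sum, Finset.sum_mul]
        simp only [mul_assoc]
    _ ≤ _ := mul_le_mul_of_nonneg_right hmod hC

/-- Codes small sets by a type with (|ι| + 1)^N elements, `none` serving as padding, for the union
bound over S. -/
theorem exists_fin_option_range {ι : Type*} (S : Finset ι) (N : ℕ) (h : S.card ≤ N) :
    ∃ g : Fin N → Option ι, ∀ i, i ∈ S ↔ ∃ t, g t = some i := by
  refine ⟨fun t => if ht : (t : ℕ) < S.card then some (S.equivFin.symm ⟨t, ht⟩ : ι) else none,
    fun i => ⟨fun hi => ?_, ?_⟩⟩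
  · refine ⟨⟨S.equivFin ⟨i, hi⟩, (Fin.is_lt _).trans_le h⟩, ?_⟩
    simp
  · rintro ⟨t, ht⟩
    simp only at ht
    split_ifs at ht with h1
    rw [← Option.some.inj ht]
    exact Subtype.mem _

/-- Codes subspaces by N-tuples of vectors, a basis padded with zeros, for the union bound over B.
-/
theorem exists_fin_span_range {K V : Type*} [Field K] [AddCommGroup V] [Module K V]
    [FiniteDimensional K V] (B : Submodule K V) (N : ℕ) (h : Module.finrank K V ≤ N) :
    ∃ b : Fin N → V, B = Submodule.span K (Set.range b) := by
  have hB : Module.finrank K B ≤ N := (Submodule.finrank_le B).trans h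
  let e := Module.finBasis K B
  refine ⟨fun t => if ht : (t : ℕ) < Module.finrank K B then (e ⟨t, ht⟩ : V) else 0, ?_⟩
  apply le_antisymm
  · have h1 : B = (Submodule.span K (Set.range e)).map B.subtype := by
      rw [e.span_eq, Submodule.map_top, Submodule.range_subtype]
    conv_lhs => rw [h1]
    rw [Submodule.map_span]
    refine Submodule.span_mono ?_
    rintro _ ⟨_, ⟨t, rfl⟩, rfl⟩
    exact ⟨⟨t, t.2.trans_le hB⟩, by simp⟩
  · rw [Submodule.span_le]
    rintro _ ⟨t, rfl⟩
    simp only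
    split_ifs
    · exact Subtype.mem _
    · exact B.zero_mem

end Structure

/-! ### Sparse eigenvectors are unlikely -/

section Bad

variable {p : ℕ} [Fact p.Prime] {E ι : Type*} [Field E] [Algebra (ZMod p) E]
  [Fintype ι]

/-- Multiplying by a power of a generator moves a vector out of the kernel of a character. -/
theorem exists_pow_mul_notMem_ker {χ : AddChar E ℂ} (hχ : χ ≠ 1) {lam : E}
    (hlam : Algebra.adjoin (ZMod p) {lam} = ⊤) {a : E} (ha : a ≠ 0) :
    ∃ t : ℕ, χ (lam ^ t * a) ≠ 1 := by
  by_contra! h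
  refine hχ (DFunLike.ext _ _ fun y => ?_)
  -- Every y is a polynomial in `lam` times a, hence an 𝔽_p-combination of the elements `lam ^ t *
  -- a`.
  have hy : y * a⁻¹ ∈ Algebra.adjoin (ZMod p) {lam} := by rw [hlam]; trivial
  rw [Algebra.adjoin_singleton_eq_range_aeval] at hy
  obtain ⟨f, hf⟩ := hy
  have h1 : y = ∑ t ∈ Finset.range (f.natDegree + 1), f.coeff t • (lam ^ t * a) := by
    have h2 : y = aeval lam f * a := by
      rw [show aeval lam f = y * a⁻¹ from hf, mul_assoc, inv_mul_cancel₀ ha, mul_one]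
    rw [h2, aeval_eq_sum_range, Finset.sum_mul]
    simp only [smul_mul_assoc]
  have h3 : y ∈ (χ.zmodKer : Submodule (ZMod p) E) := by
    rw [h1]
    exact Submodule.sum_mem _ fun t _ => Submodule.smul_mem _ _ (h t)
  exact h3

/-- `w` is a nonzero left eigenvector with eigenvalue `lam` on the columns in `J`, on which `χ` is
trivial at all but fewer than `r` coordinates. -/
def IsSparseEigenvector (χ : AddChar E ℂ) (lam : E) (J : Finset ι) (r : ℕ)
    (A : ι → ι → ZMod p) (w : ι → E) : Prop :=
  w ≠ 0 ∧ (∀ j ∈ J, ∑ i, A j i • w i = lam * w j) ∧ {i | χ (w i) ≠ 1}.ncard < r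

/-- Only the columns in J enter, so later columns can be exposed after conditioning on the absence
of sparse eigenvectors. -/
theorem IsSparseEigenvector.congr {χ : AddChar E ℂ} {lam : E}
    {J : Finset ι} {r : ℕ} {A A' : ι → ι → ZMod p} {w : ι → E} (h : ∀ j ∈ J, A j = A' j) :
    IsSparseEigenvector χ lam J r A w ↔ IsSparseEigenvector χ lam J r A' w := by
  unfold IsSparseEigenvector
  have : (∀ j ∈ J, ∑ i, A j i • w i = lam * w j) ↔ ∀ j ∈ J, ∑ i, A' j i • w i = lam * w j :=
    forall₂_congr fun j hj => by rw [h j hj]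
  rw [this]

/-- A sparse eigenvector may be chosen with nonempty support, if few columns are missing. -/
theorem IsSparseEigenvector.exists_ne_one [DecidableEq ι] {χ : AddChar E ℂ} (hχ : χ ≠ 1) {lam : E}
    (hlam : Algebra.adjoin (ZMod p) {lam} = ⊤) {J : Finset ι} {r : ℕ} (hJ : Jᶜ.card < r)
    {A : ι → ι → ZMod p} {w : ι → E} (hw : IsSparseEigenvector χ lam J r A w) :
    ∃ w', IsSparseEigenvector χ lam J r A w' ∧ ∃ i, χ (w' i) ≠ 1 := by
  classical
  obtain ⟨hw0, hwJ, hwr⟩ := hw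
  obtain ⟨i₁, hi₁⟩ := Function.ne_iff.mp hw0
  have hex : ∃ t : ℕ, ∃ i, χ (lam ^ t * w i) ≠ 1 := by
    obtain ⟨t, ht⟩ := exists_pow_mul_notMem_ker hχ hlam hi₁
    exact ⟨t, i₁, ht⟩
  have hJt : ∀ t : ℕ, ∀ j ∈ J, ∑ i, A j i • (lam ^ t * w i) = lam ^ (t + 1) * w j := by
    intro t j hj
    rw [pow_succ, mul_assoc, ← hwJ j hj, Finset.mul_sum]
    simp only [mul_smul_comm]
  -- Take the least t for which `lam ^ t * w` leaves ker χ. If t > 0, the eigenvector equation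
  -- writes its coordinates in J as 𝔽_p-combinations of those of `lam ^ (t - 1) * w`, which lie in
  -- ker χ; the exceptional coordinates are then outside J.
  obtain ⟨t, hmin, ht⟩ : ∃ t : ℕ, (∀ u < t, ∀ i, χ (lam ^ u * w i) = 1) ∧
      ∃ i, χ (lam ^ t * w i) ≠ 1 := by
    refine ⟨Nat.find hex, fun u hu i => ?_, Nat.find_spec hex⟩
    have := Nat.find_min hex hu
    push Not at this
    exact this i
  refine ⟨fun i => lam ^ t * w i, ⟨?_, fun j hj => ?_, ?_⟩, ht⟩
  · obtain ⟨i, hi⟩ := ht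
    intro h0
    have := congrFun h0 i
    simp only [Pi.zero_apply] at this
    rw [this, AddChar.map_zero_eq_one] at hi
    exact hi rfl
  · rw [hJt t j hj, pow_succ']; ring
  · cases t with
    | zero => simpa using hwr
    | succ u =>
      refine lt_of_le_of_lt ?_ hJ
      rw [← Set.ncard_coe_finset]
      refine Set.ncard_le_ncard ?_ (Set.toFinite _)
      intro i hi
      simp only [Finset.coe_compl, Set.mem_compl_iff, Finset.mem_coe]
      intro hiJ
      refine hi ?_
      change χ (lam ^ (u + 1) * w i) = 1
      rw [← hJt u i hiJ]
      have h3 : ∑ l, A i l • (lam ^ u * w l) ∈ (χ.zmodKer : Submodule (ZMod p) E) :=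
        Submodule.sum_mem _ fun l _ => Submodule.smul_mem _ _ (hmin u (Nat.lt_succ_self u) l)
      exact h3

variable [Fintype E]

open Classical in
/-- The vectors with coordinates off `S` robustly spanning `B`, and not all coordinates in `B`. -/
def robustVectors (r : ℕ) (S : Finset ι) (B : Submodule (ZMod p) E) : Set (ι → E) :=
  {w | (∀ i, i ∉ S → w i ∈ B) ∧
    (∀ H : Submodule (ZMod p) E, H < B →
      r ≤ (Finset.univ.filter fun i => i ∉ S ∧ w i ∉ H).card) ∧ ∃ i, w i ∉ B}

/-- The robust span B lies in ker χ: otherwise B ⊓ ker χ would be proper in B and at least r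
coordinates would lie outside ker χ. A coordinate with χ ≠ 1 is therefore outside B. -/
theorem exists_mem_robustVectors {χ : AddChar E ℂ} {r : ℕ} {w : ι → E}
    (hr : {i | χ (w i) ≠ 1}.ncard < r) (hw : ∃ i, χ (w i) ≠ 1) :
    ∃ (S : Finset ι) (B : Submodule (ZMod p) E), S.card ≤ r * Module.finrank (ZMod p) E ∧
      w ∈ robustVectors r S B := by
  classical
  obtain ⟨S, B, hS, hSB, hB⟩ := exists_robust_span (K := ZMod p) w r
  refine ⟨S, B, hS, hSB, hB, ?_⟩
  have hle : B ≤ χ.zmodKer := by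
    by_contra hnot
    have hlt : B ⊓ χ.zmodKer < B := lt_of_le_of_ne inf_le_left fun h => hnot (inf_eq_left.mp h)
    have h1 := hB _ hlt
    refine absurd (h1.trans_lt' hr) (not_lt.mpr ?_)
    rw [← Set.ncard_coe_finset]
    refine Set.ncard_le_ncard ?_ (Set.toFinite _)
    intro i hi
    simp only [Finset.coe_filter, Finset.mem_univ, true_and, Submodule.mem_inf, not_and,
      Set.mem_ofPred_eq] at hi
    exact hi.2 (hSB i hi.1)
  obtain ⟨i, hi⟩ := hw
  exact ⟨i, fun h => hi (hle h)⟩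

open Classical in
theorem card_robustVectors_le [DecidableEq ι] (r : ℕ) (S : Finset ι) (B : Submodule (ZMod p) E) :
    (Finset.univ.filter fun w : ι → E => w ∈ robustVectors r S B).card
      ≤ Fintype.card E ^ S.card * Fintype.card B ^ Fintype.card ι := by
  let t : ι → Finset E := fun i => if i ∈ S then Finset.univ else Finset.univ.filter fun y => y ∈ B
  have h1 : (Finset.univ.filter fun w : ι → E => w ∈ robustVectors r S B)
      ⊆ Fintype.piFinset t := by
    intro w hw
    simp only [Finset.mem_filter, Finset.mem_univ, true_and] at hw
    rw [Fintype.mem_piFinset]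
    intro i
    by_cases hi : i ∈ S
    · simp [t, hi]
    · simp [t, hi, hw.1 i hi]
  refine (Finset.card_le_card h1).trans ?_
  rw [Fintype.card_piFinset]
  have h2 : ∀ i, (t i).card = (if i ∈ S then Fintype.card E else 1)
      * (if i ∈ S then 1 else Fintype.card B) := by
    intro i
    by_cases hi : i ∈ S
    · simp [t, hi]
    · simp [t, hi, Fintype.card_subtype]
  rw [Finset.prod_congr rfl fun i _ => h2 i, Finset.prod_mul_distrib]
  refine Nat.mul_le_mul ?_ ?_
  · rw [Finset.prod_ite]; simp
  · refine (Finset.prod_le_pow_card _ _ (Fintype.card B) fun i _ => ?_).trans_eq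
      (by rw [Finset.card_univ])
    split_ifs
    · exact Fintype.card_pos
    · exact le_rfl

variable {μ : ZMod p → ℝ}

open Classical in
/-- Sparse eigenvectors are unlikely. -/
theorem mass_exists_isSparseEigenvector_le [DecidableEq ι] (hμ : IsWeight μ) {b g : ℝ}
    (hb : ∀ a, μ a ≤ b) (hg0 : 0 ≤ g) (hg1 : g ≤ 1)
    (hg : ∀ ψ : AddChar (ZMod p) ℂ, ψ ≠ 1 → ‖∑ a, (μ a : ℂ) * ψ a‖ ≤ g)
    {χ : AddChar E ℂ} (hχ : χ ≠ 1) {lam : E} (hlam : Algebra.adjoin (ZMod p) {lam} = ⊤)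
    {J : Finset ι} {r : ℕ} (hJ : Jᶜ.card < r) :
    mass (prodWeight (prodWeight μ))
        (fun A : ι → ι → ZMod p => ∃ w, IsSparseEigenvector χ lam J r A w)
      ≤ ((Fintype.card ι : ℝ) + 1) ^ (r * Module.finrank (ZMod p) E)
        * (Fintype.card E : ℝ) ^
          (Module.finrank (ZMod p) E + r * Module.finrank (ZMod p) E + Jᶜ.card)
        * (b * (1 + Fintype.card E * g ^ r)) ^ J.card := by
  set d := Module.finrank (ZMod p) E with hd
  set q := Fintype.card E with hq
  have hb0 : 0 ≤ b := (hμ.nonneg 0).trans (hb 0)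
  have hμ' : IsWeight (prodWeight μ : (ι → ZMod p) → ℝ) := hμ.prodWeight
  have hμ'' : IsWeight (prodWeight (prodWeight μ) : (ι → ι → ZMod p) → ℝ) := hμ'.prodWeight
  let S : (Fin (r * d) → Option ι) → Finset ι := fun a =>
    Finset.univ.filter fun i => ∃ t, a t = some i
  let B : (Fin d → E) → Submodule (ZMod p) E := fun c => Submodule.span _ (Set.range c)
  have hSc : ∀ a, (S a).card ≤ r * d := by
    intro a
    have h1 : ((S a).map Function.Embedding.some) ⊆ Finset.univ.image a := by
      intro o ho
      simp only [S, Finset.mem_map, Finset.mem_filter, Finset.mem_univ, true_and] at ho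
      obtain ⟨i, ⟨t, ht⟩, rfl⟩ := ho
      exact Finset.mem_image.mpr ⟨t, Finset.mem_univ _, ht⟩
    have h2 := (Finset.card_le_card h1).trans Finset.card_image_le
    simpa using h2
  have hq1 : (1 : ℝ) ≤ q := by exact_mod_cast Fintype.card_pos
  -- the contribution of one pair `(S, B)`
  have hone : ∀ k : (Fin (r * d) → Option ι) × (Fin d → E),
      mass (prodWeight (prodWeight μ)) (fun A : ι → ι → ZMod p =>
        ∃ w : ι → E, w ∈ robustVectors r (S k.1) (B k.2) ∧ ∀ j ∈ J, ∑ i, A j i • w i = lam * w j)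
      ≤ (q : ℝ) ^ (r * d + Jᶜ.card) * (b * (1 + q * g ^ r)) ^ J.card := by
    rintro ⟨a, c⟩
    simp only
    set ρ := b * (1 / (Fintype.card (B c) : ℝ) + g ^ r) with hρ
    have hβ1 : (1 : ℝ) ≤ Fintype.card (B c) := by exact_mod_cast Fintype.card_pos
    have hβq : (Fintype.card (B c) : ℝ) ≤ q := by
      exact_mod_cast Fintype.card_subtype_le _
    have hρ0 : 0 ≤ ρ := by positivity
    have hw : ∀ w : ι → E, mass (prodWeight (prodWeight μ)) (fun A : ι → ι → ZMod p =>
        w ∈ robustVectors r (S a) (B c) ∧ ∀ j ∈ J, ∑ i, A j i • w i = lam * w j)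
        ≤ if w ∈ robustVectors r (S a) (B c) then ρ ^ J.card else 0 := by
      intro w
      split_ifs with h
      · simp only [h, true_and]
        rw [mass_prodWeight_forall hμ' J (fun j x => ∑ i, x i • w i = lam * w j)]
        obtain ⟨h1, h2, i₀, h3⟩ := h
        rw [← Finset.prod_const]
        exact Finset.prod_le_prod (fun j _ => hμ'.mass_nonneg _)
          fun j _ => mass_sum_smul_eq_le hμ hb hg0 hg1 hg w r _ _ h1
            (fun H hH => by convert h2 H hH) i₀ h3 _
      · simp only [h, false_and]
        exact mass_false.le
    refine (hμ''.mass_exists_le _).trans ((Finset.sum_le_sum fun w _ => hw w).trans ?_)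
    rw [← Finset.sum_filter, Finset.sum_const, nsmul_eq_mul]
    have hcard : ((Finset.univ.filter fun w : ι → E => w ∈ robustVectors r (S a) (B c)).card : ℝ)
        ≤ (q : ℝ) ^ (r * d) * (Fintype.card (B c) : ℝ) ^ Fintype.card ι := by
      have h1 := card_robustVectors_le r (S a) (B c)
      have h2 : (q : ℝ) ^ (S a).card ≤ (q : ℝ) ^ (r * d) := pow_le_pow_right₀ hq1 (hSc a)
      calc _ ≤ (q : ℝ) ^ (S a).card * (Fintype.card (B c) : ℝ) ^ Fintype.card ι := by
            exact_mod_cast h1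
        _ ≤ _ := by gcongr
    have hsplit : Fintype.card ι = Jᶜ.card + J.card := by
      rw [Finset.card_compl]
      have := Finset.card_le_univ J
      omega
    -- The decisive cancellation: |B|^|J| from the count of vectors absorbs the denominators in
    -- ρ^|J|, leaving only |B| to the number of missing columns.
    calc _ ≤ (q : ℝ) ^ (r * d) * (Fintype.card (B c) : ℝ) ^ Fintype.card ι * ρ ^ J.card := by
          gcongr
      _ = (q : ℝ) ^ (r * d) * (Fintype.card (B c) : ℝ) ^ Jᶜ.card
          * (b * (1 + Fintype.card (B c) * g ^ r)) ^ J.card := by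
          have : (Fintype.card (B c) : ℝ) ^ J.card * ρ ^ J.card
              = (b * (1 + Fintype.card (B c) * g ^ r)) ^ J.card := by
            rw [← mul_pow, hρ]
            congr 1
            field_simp
          rw [hsplit, pow_add, ← this]
          ring
      _ ≤ (q : ℝ) ^ (r * d) * (q : ℝ) ^ Jᶜ.card * (b * (1 + q * g ^ r)) ^ J.card := by
          gcongr
      _ = _ := by rw [pow_add]
  have hmono : ∀ A : ι → ι → ZMod p, (∃ w, IsSparseEigenvector χ lam J r A w) →
      ∃ k : (Fin (r * d) → Option ι) × (Fin d → E), ∃ w : ι → E,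
        w ∈ robustVectors r (S k.1) (B k.2) ∧ ∀ j ∈ J, ∑ i, A j i • w i = lam * w j := by
    rintro A ⟨w, hw⟩
    obtain ⟨w', ⟨-, hw2, hw3⟩, hw4⟩ := hw.exists_ne_one hχ hlam hJ
    obtain ⟨S', B', h1, h2⟩ := exists_mem_robustVectors (p := p) hw3 hw4
    obtain ⟨a, ha⟩ := exists_fin_option_range S' _ h1
    obtain ⟨c, hc⟩ := exists_fin_span_range B' d le_rfl
    have hS' : S a = S' := by
      ext i
      simp only [S, Finset.mem_filter, Finset.mem_univ, true_and]
      exact (ha i).symm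
    refine ⟨(a, c), w', ?_, hw2⟩
    simp only [hS']
    rw [show B c = B' from hc.symm]
    exact h2
  refine (hμ''.mass_mono hmono).trans ((hμ''.mass_exists_le _).trans
    ((Finset.sum_le_sum fun k _ => hone k).trans_eq ?_))
  rw [Finset.sum_const, nsmul_eq_mul, Finset.card_univ, Fintype.card_prod, Fintype.card_fun,
    Fintype.card_fun, Fintype.card_option, Fintype.card_fin, Fintype.card_fin]
  push_cast
  rw [add_assoc d, pow_add (q : ℝ) d]
  ring

end Bad

/-! ### Determining coordinates and the codimension bound -/

section Determining

/-- A subspace is determined by as many coordinates as its dimension. -/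
theorem exists_determining_coordinates {K ι : Type*} [Field K] [Fintype ι] [DecidableEq ι]
    (W : Submodule K (ι → K)) :
    ∃ T : Finset ι, T.card ≤ Module.finrank K W ∧ ∀ w ∈ W, (∀ i ∈ T, w i = 0) → w = 0 := by
  let U : Finset ι → Submodule K (ι → K) := fun T =>
    W ⊓ ⨅ i ∈ T, LinearMap.ker (LinearMap.proj (R := K) (φ := fun _ : ι => K) i)
  have hU : ∀ T w, w ∈ U T ↔ w ∈ W ∧ ∀ i ∈ T, w i = 0 := by
    intro T w
    simp [U]
  -- Among the T that pay for themselves in dimension, take one leaving the least dimension; a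
  -- surviving nonzero vector would supply one more useful coordinate.
  obtain ⟨T, hT, hmin⟩ := Finset.exists_min_image
    ((Finset.univ : Finset (Finset ι)).filter fun T =>
      T.card + Module.finrank K (U T) ≤ Module.finrank K W)
    (fun T => Module.finrank K (U T))
    ⟨∅, by
      have : Module.finrank K (U ∅) ≤ Module.finrank K W := Submodule.finrank_mono inf_le_left
      simpa using this⟩
  simp only [Finset.mem_filter, Finset.mem_univ, true_and] at hT hmin
  refine ⟨T, by omega, fun w hw hwT => ?_⟩
  by_contra hne
  obtain ⟨i, hi⟩ := Function.ne_iff.mp hne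
  have hiT : i ∉ T := fun h => hi (hwT i h)
  have hlt : U (insert i T) < U T := by
    refine lt_of_le_of_ne (fun x hx => ?_) fun heq => ?_
    · rw [hU] at hx ⊢
      exact ⟨hx.1, fun j hj => hx.2 j (Finset.mem_insert_of_mem hj)⟩
    · have h1 : w ∈ U (insert i T) := by rw [heq, hU]; exact ⟨hw, hwT⟩
      rw [hU] at h1
      exact hi (h1.2 i (Finset.mem_insert_self _ _))
  have h2 := Submodule.finrank_lt_finrank_of_lt hlt
  have h3 := Finset.card_insert_of_notMem hiT
  have h4 := hmin (insert i T) (by omega)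
  omega

variable {p : ℕ} [Fact p.Prime] {E ι : Type*} [Field E] [Algebra (ZMod p) E]
  [Fintype ι] [DecidableEq ι] {μ : ZMod p → ℝ}

/-- A random vector lies in a translate of a subspace with probability exponentially small in the
codimension. -/
theorem mass_sub_mem_le (hμ : IsWeight μ) {b : ℝ} (hb : ∀ a, μ a ≤ b) (hb1 : b ≤ 1)
    (W : Submodule E (ι → E)) (s : ι → E) :
    mass (prodWeight μ) (fun x : ι → ZMod p => (fun i => algebraMap (ZMod p) E (x i)) - s ∈ W)
      ≤ b ^ (Fintype.card ι - Module.finrank E W) := by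
  have hb0 : 0 ≤ b := (hμ.nonneg 0).trans (hb 0)
  obtain ⟨T, hT, hW⟩ := exists_determining_coordinates W
  -- Once the coordinates in T are fixed, at most one completion lies in the translate, so each
  -- coordinate off T costs a factor b.
  rw [mass_resample hμ T]
  refine hμ.prodWeight.sum_mul_le fun x => ?_
  by_cases hex : ∃ y : ι → ZMod p,
      (fun i => algebraMap (ZMod p) E (T.piecewise x y i)) - s ∈ W
  · obtain ⟨y₀, hy₀⟩ := hex
    refine (hμ.prodWeight.mass_mono (R := fun y => ∀ i ∈ Tᶜ, y i = y₀ i) ?_).trans ?_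
    · intro y hy i hi
      have h1 := hW _ (W.sub_mem hy hy₀) (fun j hj => by simp [hj])
      have h2 := congrFun h1 i
      rw [Finset.mem_compl] at hi
      simp only [sub_sub_sub_cancel_right, Pi.sub_apply, Finset.piecewise_eq_of_notMem _ _ _ hi,
        Pi.zero_apply, sub_eq_zero] at h2
      exact (algebraMap (ZMod p) E).injective h2
    · rw [mass_prodWeight_forall hμ Tᶜ (fun i a => a = y₀ i)]
      refine (Finset.prod_le_prod (fun _ _ => hμ.mass_nonneg _) fun i _ =>
        mass_le_of_subsingleton hb hb0 fun a a' h h' => h.trans h'.symm).trans ?_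
      rw [Finset.prod_const, Finset.card_compl]
      exact pow_le_pow_of_le_one hb0 hb1 (by omega)
  · push Not at hex
    have : mass (prodWeight μ)
        (fun y : ι → ZMod p => (fun i => algebraMap (ZMod p) E (T.piecewise x y i)) - s ∈ W)
        = 0 := by
      rw [← mass_false (ν := (prodWeight μ : (ι → ZMod p) → ℝ))]
      congr 1
      ext y
      simp [hex y]
    rw [this]
    positivity

end Determining

/-! ### Spans of initial columns -/

section Span

variable {K V : Type*} [Field K] [AddCommGroup V] [Module K V] {n : ℕ}

/-- The span of the first `l` vectors. -/
def initSpan (K : Type*) {V : Type*} [Field K] [AddCommGroup V] [Module K V] {n : ℕ}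
    (c : Fin n → V) (l : ℕ) : Submodule K V :=
  Submodule.span K (c '' {i | (i : ℕ) < l})

theorem initSpan_zero (c : Fin n → V) : initSpan K c 0 = ⊥ := by
  simp [initSpan]

theorem initSpan_congr {c c' : Fin n → V} {l : ℕ} (h : ∀ i : Fin n, (i : ℕ) < l → c i = c' i) :
    initSpan K c l = initSpan K c' l := by
  unfold initSpan
  congr 1
  exact Set.image_congr h

theorem initSpan_succ (c : Fin n → V) (l : Fin n) :
    initSpan K c (l + 1) = initSpan K c l ⊔ Submodule.span K {c l} := by
  unfold initSpan
  rw [← Submodule.span_union, ← Set.image_singleton, ← Set.image_union]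
  congr 2
  ext i
  simp only [Set.mem_ofPred_eq, Set.union_singleton, Set.mem_insert_iff, Fin.ext_iff]
  omega

theorem finrank_initSpan_succ_le [FiniteDimensional K V] (c : Fin n → V) (l : Fin n) :
    Module.finrank K (initSpan K c (l + 1)) ≤ Module.finrank K (initSpan K c l) + 1 := by
  rw [initSpan_succ]
  refine (Submodule.finrank_add_le_finrank_add_finrank _ _).trans ?_
  exact Nat.add_le_add_left ((finrank_span_le_card _).trans (by simp)) _

theorem finrank_initSpan_le [FiniteDimensional K V] (c : Fin n → V) {l : ℕ} (hl : l ≤ n) :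
    Module.finrank K (initSpan K c l) ≤ l := by
  induction l with
  | zero => simp [initSpan_zero]
  | succ l ih =>
    have := finrank_initSpan_succ_le (K := K) c ⟨l, hl⟩
    have := ih (by omega)
    simp only at *
    omega

/-- A new vector raises the rank by at most one. This turns nonsingularity into a chain of
one-column events. -/
theorem finrank_initSpan_succ_eq_iff [FiniteDimensional K V] (c : Fin n → V) (l : Fin n) :
    Module.finrank K (initSpan K c (l + 1)) = l + 1 ↔
      Module.finrank K (initSpan K c l) = l ∧ c l ∉ initSpan K c l := by
  have h1 := finrank_initSpan_succ_le (K := K) c l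
  have h2 := finrank_initSpan_le (K := K) c l.2.le
  by_cases hc : c l ∈ initSpan K c l
  · have h3 : initSpan K c (l + 1) = initSpan K c l := by
      rw [initSpan_succ]
      exact sup_eq_left.mpr ((Submodule.span_singleton_le_iff_mem _ _).mpr hc)
    rw [h3]
    constructor
    · intro h; omega
    · intro h; exact absurd hc h.2
  · have h3 : initSpan K c l < initSpan K c (l + 1) := by
      rw [initSpan_succ]
      refine left_lt_sup.mpr fun h => hc ((Submodule.span_singleton_le_iff_mem _ _).mp h)
    have h4 := Submodule.finrank_lt_finrank_of_lt h3
    simp only [hc, not_false_iff, and_true]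
    omega

theorem finrank_initSpan_eq_iff_det {c : Fin n → Fin n → K} :
    Module.finrank K (initSpan K c n) = n ↔ (Matrix.of c).det ≠ 0 := by
  have h1 : initSpan K c n = Submodule.span K (Set.range c) := by
    unfold initSpan
    congr 1
    ext; simp
  rw [h1, ← isUnit_iff_ne_zero, ← Matrix.isUnit_iff_isUnit_det,
    ← Matrix.linearIndependent_rows_iff_isUnit]
  change _ ↔ LinearIndependent K c
  rw [linearIndependent_iff_card_eq_finrank_span, Fintype.card_fin, Set.finrank, eq_comm]

end Span

/-! ### Exposing the columns one at a time -/

section Sequential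

variable {p : ℕ} [Fact p.Prime] {E : Type*} [Field E] [Algebra (ZMod p) E] {n : ℕ}
  {μ : ZMod p → ℝ}

/-- The columns of `M - lam`, where `A` is the list of columns of `M`. -/
def shiftedColumn (lam : E) (A : Fin n → Fin n → ZMod p) (j : Fin n) : Fin n → E :=
  (fun i => algebraMap (ZMod p) E (A j i)) - Pi.single j lam

/-- Probability that a new column is dependent on the previous ones, relative to an event that
depends on the previous columns. -/
theorem mass_and_column_mem_bounds (hμ : IsWeight μ) (lam : E) (l : Fin n)
    (Q : (Fin n → Fin n → ZMod p) → Prop) (hQ : ∀ A x, Q (Function.update A l x) ↔ Q A)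
    (lo hi : ℝ)
    (h : ∀ A, Q A → mass (prodWeight μ) (fun x : Fin n → ZMod p =>
        (fun i => algebraMap (ZMod p) E (x i)) - Pi.single l lam
          ∈ initSpan E (shiftedColumn lam A) l) ∈ Set.Icc lo hi) :
    mass (prodWeight (prodWeight μ)) (fun A : Fin n → Fin n → ZMod p =>
        Q A ∧ shiftedColumn lam A l ∈ initSpan E (shiftedColumn lam A) l)
      ∈ Set.Icc (mass (prodWeight (prodWeight μ)) Q * lo)
        (mass (prodWeight (prodWeight μ)) Q * hi) := by
  classical
  have hμ' : IsWeight (prodWeight μ : (Fin n → ZMod p) → ℝ) := hμ.prodWeight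
  have hspan : ∀ (A : Fin n → Fin n → ZMod p) (x : Fin n → ZMod p),
      initSpan E (shiftedColumn lam (Function.update A l x)) l
        = initSpan E (shiftedColumn lam A) l := by
    intro A x
    refine initSpan_congr fun i hi => ?_
    have : i ≠ l := by rintro rfl; exact lt_irrefl _ hi
    simp [shiftedColumn, Function.update_of_ne this]
  have hcol : ∀ (A : Fin n → Fin n → ZMod p) (x : Fin n → ZMod p),
      shiftedColumn lam (Function.update A l x) l
        = (fun i => algebraMap (ZMod p) E (x i)) - Pi.single l lam := by
    intro A x
    simp [shiftedColumn]
  -- Resample the column l alone: neither Q nor the span of the earlier columns changes.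
  rw [mass_update hμ' l (fun A : Fin n → Fin n → ZMod p =>
        Q A ∧ shiftedColumn lam A l ∈ initSpan E (shiftedColumn lam A) l), mass_eq_sum Q,
    Finset.sum_mul, Finset.sum_mul]
  simp only [hQ, hspan, hcol]
  have hin : ∀ A : Fin n → Fin n → ZMod p, ¬ Q A → mass (prodWeight μ)
      (fun x : Fin n → ZMod p => Q A ∧ (fun i => algebraMap (ZMod p) E (x i)) - Pi.single l lam
          ∈ initSpan E (shiftedColumn lam A) l) = 0 := by
    intro A hA
    simp only [hA, false_and]
    exact mass_false
  constructor
  · refine Finset.sum_le_sum fun A _ => ?_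
    rw [mul_assoc]
    refine mul_le_mul_of_nonneg_left ?_ (hμ'.prodWeight.nonneg A)
    by_cases hA : Q A
    · simpa [hA] using (h A hA).1
    · rw [hin A hA]; simp [hA]
  · refine Finset.sum_le_sum fun A _ => ?_
    rw [mul_assoc]
    refine mul_le_mul_of_nonneg_left ?_ (hμ'.prodWeight.nonneg A)
    by_cases hA : Q A
    · simpa [hA] using (h A hA).2
    · rw [hin A hA]; simp [hA]

/-- Before column k the span has codimension at least n - k, so each step fails with probability at
most b^(n-k); equidistribution is not needed here. -/
theorem mass_finrank_initSpan_ne_le (hμ : IsWeight μ) {b : ℝ} (hb : ∀ a, μ a ≤ b) (hb1 : b ≤ 1)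
    (lam : E) {k : ℕ} (hk : k ≤ n) {l : ℕ} (hl : l ≤ k) :
    mass (prodWeight (prodWeight μ)) (fun A : Fin n → Fin n → ZMod p =>
      Module.finrank E (initSpan E (shiftedColumn lam A) l) ≠ l) ≤ l * b ^ (n - k) := by
  have hb0 : 0 ≤ b := (hμ.nonneg 0).trans (hb 0)
  have hμ'' : IsWeight (prodWeight (prodWeight μ) : (Fin n → Fin n → ZMod p) → ℝ) :=
    hμ.prodWeight.prodWeight
  induction l with
  | zero => simp [initSpan_zero, mass_false]
  | succ l ih =>
    have hln : l < n := by omega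
    have h1 := mass_and_column_mem_bounds hμ lam ⟨l, hln⟩ (fun _ => True) (fun _ _ => Iff.rfl)
      0 (b ^ (n - k)) (fun A _ => ⟨hμ.prodWeight.mass_nonneg _, ?_⟩)
    · rw [mass_true hμ'', one_mul, one_mul] at h1
      simp only [true_and] at h1
      calc _ ≤ mass (prodWeight (prodWeight μ)) (fun A : Fin n → Fin n → ZMod p =>
            Module.finrank E (initSpan E (shiftedColumn lam A) l) ≠ l ∨
            shiftedColumn lam A ⟨l, hln⟩ ∈ initSpan E (shiftedColumn lam A) l) := by
            refine hμ''.mass_mono fun A hA => ?_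
            have := finrank_initSpan_succ_eq_iff (K := E) (shiftedColumn lam A) ⟨l, hln⟩
            simp only at this
            rw [Ne, this] at hA
            tauto
        _ ≤ l * b ^ (n - k) + b ^ (n - k) :=
            (hμ''.mass_or_le _ _).trans (add_le_add (ih (by omega)) h1.2)
        _ = _ := by push_cast; ring
    · refine (mass_sub_mem_le hμ hb hb1 _ _).trans (pow_le_pow_of_le_one hb0 hb1 ?_)
      have := finrank_initSpan_le (K := E) (shiftedColumn lam A) hln.le
      rw [Fintype.card_fin]
      simp only
      omega

variable [Fintype E]

/-- A nontrivial χ on a field is primitive, so its multiplicative shifts are distinct; there are |E|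
of them, as many as there are characters. -/
theorem AddChar.exists_eq_mulShift {χ : AddChar E ℂ} (hχ : χ ≠ 1) (ψ : AddChar E ℂ) :
    ∃ a, ψ = χ.mulShift a := by
  classical
  have h1 := (AddChar.to_mulShift_inj_of_isPrimitive (AddChar.IsPrimitive.of_ne_one hχ))
  have h2 := (Fintype.bijective_iff_injective_and_card _).mpr ⟨h1, AddChar.card_eq.symm⟩
  obtain ⟨a, ha⟩ := h2.2 ψ
  exact ⟨a, ha.symm⟩

/-- Every additive character of `E ^ ι` comes from a linear form. -/
theorem AddChar.exists_pi_eq {ι : Type*} [Fintype ι] [DecidableEq ι] {χ : AddChar E ℂ}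
    (hχ : χ ≠ 1) (ψ : AddChar (ι → E) ℂ) :
    ∃ w : ι → E, ∀ y, ψ y = χ (∑ i, w i * y i) := by
  have h : ∀ i, ∃ a, ψ.compAddMonoidHom (AddMonoidHom.single (fun _ : ι => E) i)
      = χ.mulShift a := fun i => AddChar.exists_eq_mulShift hχ _
  choose w hw using h
  refine ⟨w, fun y => ?_⟩
  conv_lhs => rw [← Finset.univ_sum_single y]
  rw [AddChar.map_finset_sum, AddChar.map_finset_sum]
  refine Finset.prod_congr rfl fun i _ => ?_
  have := DFunLike.congr_fun (hw i) (y i)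
  simpa using this

/-- Modulo W the column is a random combination of the images of the unit vectors. A nontrivial
character of the quotient that is trivial at all but fewer than r of them pulls back to a sparse
eigenvector. -/
theorem abs_mass_column_mem_sub_le (hμ : IsWeight μ) {g : ℝ} (hg0 : 0 ≤ g) (hg1 : g ≤ 1)
    (hg : ∀ ψ : AddChar (ZMod p) ℂ, ψ ≠ 1 → ‖∑ a, (μ a : ℂ) * ψ a‖ ≤ g)
    {χ : AddChar E ℂ} (hχ : χ ≠ 1) {lam : E} {J : Finset (Fin n)} {r : ℕ}
    (A : Fin n → Fin n → ZMod p) (hA : ¬ ∃ w, IsSparseEigenvector χ lam J r A w)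
    (W : Submodule E (Fin n → E)) (hW : ∀ j ∈ J, shiftedColumn lam A j ∈ W) (s : Fin n → E) :
    |mass (prodWeight μ) (fun x : Fin n → ZMod p =>
        (fun i => algebraMap (ZMod p) E (x i)) - s ∈ W)
      - 1 / (Fintype.card E : ℝ) ^ (n - Module.finrank E W)| ≤ g ^ r := by
  classical
  let v : Fin n → (Fin n → E) ⧸ W := fun i => W.mkQ (Pi.single i 1)
  have hv : ∀ x : Fin n → ZMod p,
      ∑ i, x i • v i = W.mkQ (fun i => algebraMap (ZMod p) E (x i)) := by
    intro x
    conv_rhs => rw [← Finset.univ_sum_single (fun i => algebraMap (ZMod p) E (x i))]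
    rw [map_sum]
    refine Finset.sum_congr rfl fun i _ => ?_
    rw [show (Pi.single i (algebraMap (ZMod p) E (x i)) : Fin n → E)
      = algebraMap (ZMod p) E (x i) • Pi.single i 1 by
        rw [← Pi.single_smul, smul_eq_mul, mul_one], map_smul, algebraMap_smul]
  have hcard : Fintype.card ((Fin n → E) ⧸ W) = Fintype.card E ^ (n - Module.finrank E W) := by
    rw [Module.card_eq_pow_finrank (K := E), Submodule.finrank_quotient, Module.finrank_fin_fun]
  have key := abs_mass_sum_smul_sub_le hμ hg0 hg1 hg v r (fun ψ hψ => ?_) (W.mkQ s)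
  · rw [hcard] at key
    push_cast at key
    have hiff : ∀ x : Fin n → ZMod p, ∑ i, x i • v i = W.mkQ s ↔
        (fun i => algebraMap (ZMod p) E (x i)) - s ∈ W := by
      intro x
      rw [hv, ← sub_eq_zero, ← map_sub, Submodule.mkQ_apply, Submodule.Quotient.mk_eq_zero]
    simpa only [hiff] using key
  · obtain ⟨w, hw⟩ := AddChar.exists_pi_eq hχ (ψ.compAddMonoidHom W.mkQ.toAddMonoidHom)
    have hw' : ∀ y, ψ (W.mkQ y) = χ (∑ i, w i * y i) := hw
    by_contra hlt
    refine hA ⟨w, ?_, fun j hj => ?_, ?_⟩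
    · rintro rfl
      refine hψ (DFunLike.ext _ _ fun y => ?_)
      obtain ⟨y, rfl⟩ := W.mkQ_surjective y
      rw [hw']
      simp
    -- W is stable under scaling by E, so χ is trivial on all multiples of w·column; primitivity
    -- forces this product to vanish.
    · have h0 : ∀ e : E, χ (∑ i, w i * shiftedColumn lam A j i * e) = 1 := by
        intro e
        have h1 := W.smul_mem e (hW j hj)
        have h2 := hw' (e • shiftedColumn lam A j)
        rw [Submodule.mkQ_apply, (Submodule.Quotient.mk_eq_zero W).mpr h1,
          AddChar.map_zero_eq_one] at h2
        rw [h2]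
        congr 1
        refine Finset.sum_congr rfl fun i _ => ?_
        simp only [Pi.smul_apply, smul_eq_mul]
        ring
      have h3 : ∑ i, w i * shiftedColumn lam A j i = 0 := by
        by_contra hne
        refine AddChar.IsPrimitive.of_ne_one hχ hne (DFunLike.ext _ _ fun e => ?_)
        rw [AddChar.mulShift_apply, Finset.sum_mul, h0 e, AddChar.one_apply]
      simp only [shiftedColumn, Pi.sub_apply, mul_sub, Finset.sum_sub_distrib] at h3
      rw [sub_eq_zero] at h3
      simp only [Algebra.smul_def]
      rw [Finset.sum_congr rfl fun i _ => mul_comm _ _, h3, Finset.sum_eq_single j]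
      · rw [Pi.single_eq_same, mul_comm]
      · intro i _ hi
        rw [Pi.single_eq_of_ne hi, mul_zero]
      · simp
    · rw [not_le, ← Set.ncard_coe_finset] at hlt
      refine lt_of_le_of_lt (le_of_eq ?_) hlt
      congr 1
      ext i
      simp only [Set.mem_ofPred_eq, Finset.coe_filter, Finset.mem_univ, true_and, v, hw']
      simp [Pi.single_apply]

/-- The probability that `M - lam` is nonsingular, up to the probabilities of bad events. -/
theorem abs_mass_finrank_initSpan_eq_sub_le (hμ : IsWeight μ) {b g : ℝ} (hb : ∀ a, μ a ≤ b)
    (hb1 : b ≤ 1) (hg0 : 0 ≤ g) (hg1 : g ≤ 1)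
    (hg : ∀ ψ : AddChar (ZMod p) ℂ, ψ ≠ 1 → ‖∑ a, (μ a : ℂ) * ψ a‖ ≤ g)
    {χ : AddChar E ℂ} (hχ : χ ≠ 1) {lam : E} {k r : ℕ} (hk : k ≤ n) {D : ℝ}
    (hD : mass (prodWeight (prodWeight μ)) (fun A : Fin n → Fin n → ZMod p =>
      ∃ w, IsSparseEigenvector χ lam (Finset.univ.filter fun j : Fin n => (j : ℕ) < k) r A w) ≤ D) :
    |mass (prodWeight (prodWeight μ)) (fun A : Fin n → Fin n → ZMod p =>
        Module.finrank E (initSpan E (shiftedColumn lam A) n) = n)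
      - ∏ i ∈ Finset.range (n - k), (1 - 1 / (Fintype.card E : ℝ) ^ (i + 1))|
      ≤ 2 * D + n * b ^ (n - k) + n * g ^ r := by
  set J := Finset.univ.filter fun j : Fin n => (j : ℕ) < k with hJ
  set q := Fintype.card E with hq
  have hb0 : 0 ≤ b := (hμ.nonneg 0).trans (hb 0)
  have hq1 : (1 : ℝ) ≤ q := by exact_mod_cast Fintype.card_pos
  have hμ'' : IsWeight (prodWeight (prodWeight μ) : (Fin n → Fin n → ZMod p) → ℝ) :=
    hμ.prodWeight.prodWeight
  let G : (Fin n → Fin n → ZMod p) → Prop := fun A => ¬ ∃ w, IsSparseEigenvector χ lam J r A w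
  let R : ℕ → (Fin n → Fin n → ZMod p) → Prop := fun l A =>
    Module.finrank E (initSpan E (shiftedColumn lam A) l) = l
  -- G depends only on the first k columns, so it can be carried along while the others are exposed.
  -- It costs D twice: at the start l = k and when it is dropped at l = n.
  let f : ℕ → ℝ := fun l => mass (prodWeight (prodWeight μ)) (fun A => G A ∧ R l A)
  have hG : mass (prodWeight (prodWeight μ)) (fun A : Fin n → Fin n → ZMod p => ¬ G A) ≤ D := by
    simpa only [G, not_not] using hD
  have hf1 : ∀ l, 0 ≤ f l ∧ f l ≤ 1 := fun l => ⟨hμ''.mass_nonneg _, hμ''.mass_le_one _⟩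
  have hstart : 1 - (D + n * b ^ (n - k)) ≤ f k := by
    have h1 := mass_compl hμ'' (fun A => G A ∧ R k A)
    have h2 : mass (prodWeight (prodWeight μ)) (fun A : Fin n → Fin n → ZMod p => ¬ (G A ∧ R k A))
        ≤ D + n * b ^ (n - k) := by
      refine (hμ''.mass_mono (R := fun A => ¬ G A ∨ ¬ R k A) fun A hA => by tauto).trans
        ((hμ''.mass_or_le _ _).trans (add_le_add hG ?_))
      refine (mass_finrank_initSpan_ne_le hμ hb hb1 lam hk le_rfl).trans ?_
      gcongr
    change 1 - (D + n * b ^ (n - k)) ≤ mass _ _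
    linarith
  have hstep : ∀ l, k ≤ l → l < n →
      |f (l + 1) - f l * (1 - 1 / (q : ℝ) ^ (n - l))| ≤ g ^ r := by
    intro l hkl hln
    have hbd := mass_and_column_mem_bounds hμ lam ⟨l, hln⟩ (fun A => G A ∧ R l A) ?_
      (1 / (q : ℝ) ^ (n - l) - g ^ r) (1 / (q : ℝ) ^ (n - l) + g ^ r) ?_
    · have h1 := mass_add_mass_and_not (ν := (prodWeight (prodWeight μ) :
        (Fin n → Fin n → ZMod p) → ℝ)) (fun A => G A ∧ R l A)
        (fun A => shiftedColumn lam A ⟨l, hln⟩ ∈ initSpan E (shiftedColumn lam A) l)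
      have h2 : f (l + 1) = mass (prodWeight (prodWeight μ)) (fun A => (G A ∧ R l A) ∧
          ¬ shiftedColumn lam A ⟨l, hln⟩ ∈ initSpan E (shiftedColumn lam A) l) := by
        change mass _ _ = _
        congr 1
        ext A
        have := finrank_initSpan_succ_eq_iff (K := E) (shiftedColumn lam A) ⟨l, hln⟩
        simp only at this
        simp only [R, this, and_assoc]
      rw [← h2] at h1
      simp only at hbd
      change _ + f (l + 1) = f l at h1
      obtain ⟨h3, h4⟩ := hbd
      change f l * _ ≤ _ at h3
      change _ ≤ f l * _ at h4
      have hgr : f l * g ^ r ≤ g ^ r := mul_le_of_le_one_left (by positivity) (hf1 l).2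
      rw [abs_le]
      constructor <;> nlinarith
    · intro A x
      have hne : ∀ j : Fin n, (j : ℕ) < l → Function.update A ⟨l, hln⟩ x j = A j := by
        intro j hj
        refine Function.update_of_ne ?_ _ _
        rintro rfl
        exact lt_irrefl _ hj
      have h1 : G (Function.update A ⟨l, hln⟩ x) ↔ G A := by
        refine not_congr (exists_congr fun w => IsSparseEigenvector.congr fun j hj => hne j ?_)
        rw [hJ, Finset.mem_filter] at hj
        omega
      have h2 : R l (Function.update A ⟨l, hln⟩ x) ↔ R l A := by
        simp only [R]
        rw [initSpan_congr (c := shiftedColumn lam (Function.update A ⟨l, hln⟩ x))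
          (c' := shiftedColumn lam A) fun i hi => by simp [shiftedColumn, hne i hi]]
      rw [h1, h2]
    · rintro A ⟨hGA, hRA⟩
      have h1 := abs_mass_column_mem_sub_le hμ hg0 hg1 hg hχ A hGA
        (initSpan E (shiftedColumn lam A) l)
        (fun j hj => Submodule.subset_span ⟨j, by
          rw [hJ, Finset.mem_filter] at hj
          exact lt_of_lt_of_le hj.2 hkl, rfl⟩) (Pi.single ⟨l, hln⟩ lam)
      rw [hRA, abs_le] at h1
      exact ⟨by linarith [h1.1], by linarith [h1.2]⟩
  -- All factors have absolute value at most 1, so the one-step errors just add.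
  have hind : ∀ t, k + t ≤ n →
      |f (k + t) - f k * ∏ l ∈ Finset.range t, (1 - 1 / (q : ℝ) ^ (n - k - l))| ≤ t * g ^ r := by
    intro t
    induction t with
    | zero => intro _; simp
    | succ t ih =>
      intro ht
      have h1 := ih (by omega)
      have h2 := hstep (k + t) (by omega) (by omega)
      rw [Finset.prod_range_succ, ← add_assoc, Nat.sub_sub]
      set a := 1 - 1 / (q : ℝ) ^ (n - (k + t)) with ha
      have ha1 : |a| ≤ 1 := by
        have h3 : 0 < 1 / (q : ℝ) ^ (n - (k + t)) := by positivity
        have h4 : 1 / (q : ℝ) ^ (n - (k + t)) ≤ 1 := by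
          rw [div_le_one (by positivity)]
          exact one_le_pow₀ hq1
        rw [abs_le]
        constructor <;> linarith
      set P := ∏ l ∈ Finset.range t, (1 - 1 / (q : ℝ) ^ (n - k - l))
      calc |f (k + t + 1) - f k * (P * a)|
          = |(f (k + t + 1) - f (k + t) * a) + (f (k + t) - f k * P) * a| := by ring_nf
        _ ≤ |f (k + t + 1) - f (k + t) * a| + |f (k + t) - f k * P| * |a| := by
            rw [← abs_mul]; exact abs_add_le _ _
        _ ≤ g ^ r + t * g ^ r * 1 := by
            refine add_le_add h2 ?_
            exact mul_le_mul h1 ha1 (abs_nonneg _) (by positivity)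
        _ = _ := by push_cast; ring
  have hend := hind (n - k) (by omega)
  have hprod : ∏ l ∈ Finset.range (n - k), (1 - 1 / (q : ℝ) ^ (n - k - l))
      = ∏ i ∈ Finset.range (n - k), (1 - 1 / (q : ℝ) ^ (i + 1)) := by
    rw [← Finset.prod_range_reflect]
    refine Finset.prod_congr rfl fun i hi => ?_
    rw [Finset.mem_range] at hi
    congr 3
    omega
  rw [hprod, show k + (n - k) = n by omega] at hend
  set P := ∏ i ∈ Finset.range (n - k), (1 - 1 / (q : ℝ) ^ (i + 1)) with hP
  have hfac : ∀ i : ℕ, 0 ≤ 1 - 1 / (q : ℝ) ^ (i + 1) ∧ 1 - 1 / (q : ℝ) ^ (i + 1) ≤ 1 := by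
    intro i
    have h3 : 0 < 1 / (q : ℝ) ^ (i + 1) := by positivity
    have h4 : 1 / (q : ℝ) ^ (i + 1) ≤ 1 := by
      rw [div_le_one (by positivity)]
      exact one_le_pow₀ hq1
    constructor <;> linarith
  have hP0 : 0 ≤ P := Finset.prod_nonneg fun i _ => (hfac i).1
  have hP1 : P ≤ 1 := Finset.prod_le_one (fun i _ => (hfac i).1) fun i _ => (hfac i).2
  have hlast : mass (prodWeight (prodWeight μ)) (R n) - f n ≤ D ∧
      0 ≤ mass (prodWeight (prodWeight μ)) (R n) - f n := by
    have h1 := mass_add_mass_and_not (ν := (prodWeight (prodWeight μ) :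
        (Fin n → Fin n → ZMod p) → ℝ)) (R n) G
    have h2 : f n = mass (prodWeight (prodWeight μ)) (fun A => R n A ∧ G A) := by
      change mass _ _ = _
      congr 1
      ext A
      exact and_comm
    have h3 := hμ''.mass_mono (Q := fun A => R n A ∧ ¬ G A) (R := fun A => ¬ G A) fun A hA => hA.2
    have h4 := hμ''.mass_nonneg (fun A => R n A ∧ ¬ G A)
    constructor <;> linarith
  have hnk : ((n - k : ℕ) : ℝ) * g ^ r ≤ n * g ^ r := by
    gcongr
    exact Nat.sub_le _ _
  change |mass (prodWeight (prodWeight μ)) (R n) - P| ≤ _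
  have hfk : |f k * P - P| ≤ D + n * b ^ (n - k) := by
    have h1 : f k * P - P = -((1 - f k) * P) := by ring
    have h2 : 0 ≤ 1 - f k := by linarith [(hf1 k).2]
    rw [h1, abs_neg, abs_of_nonneg (mul_nonneg h2 hP0)]
    refine (mul_le_of_le_one_right h2 hP1).trans ?_
    linarith
  have h5 := abs_le.mp hfk
  have h6 := abs_le.mp (hend.trans hnk)
  rw [abs_le]
  constructor <;> linarith [hlast.1, hlast.2]

end Sequential

/-! ### Truncating the infinite product -/

section InfiniteProduct

theorem one_sub_inv_pow_mem_Icc {q : ℝ} (hq : 1 ≤ q) (i : ℕ) :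
    1 - 1 / q ^ (i + 1) ∈ Set.Icc (0 : ℝ) 1 := by
  have h3 : 0 < 1 / q ^ (i + 1) := by positivity
  have h4 : 1 / q ^ (i + 1) ≤ 1 := by
    rw [div_le_one (by positivity)]
    exact one_le_pow₀ hq
  constructor <;> linarith

theorem prod_one_sub_inv_pow_mem_Icc {q : ℝ} (hq : 1 ≤ q) (N : ℕ) :
    ∏ i ∈ Finset.range N, (1 - 1 / q ^ (i + 1)) ∈ Set.Icc (0 : ℝ) 1 :=
  ⟨Finset.prod_nonneg fun i _ => (one_sub_inv_pow_mem_Icc hq i).1,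
    Finset.prod_le_one (fun i _ => (one_sub_inv_pow_mem_Icc hq i).1)
      fun i _ => (one_sub_inv_pow_mem_Icc hq i).2⟩

theorem tendsto_prod_one_sub_inv_pow {q : ℝ} (hq : 2 ≤ q) :
    Filter.Tendsto (fun N => ∏ i ∈ Finset.range N, (1 - 1 / q ^ (i + 1))) Filter.atTop
      (nhds (∏' i : ℕ, (1 - 1 / q ^ (i + 1)))) := by
  have hs : Summable fun i : ℕ => ‖-(1 / q ^ (i + 1))‖ := by
    have h1 : Summable fun i : ℕ => (1 / q) ^ i :=
      summable_geometric_of_lt_one (by positivity) (by rw [div_lt_one] <;> linarith)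
    refine ((summable_nat_add_iff 1).mpr h1).congr fun i => ?_
    rw [norm_neg, Real.norm_eq_abs, abs_of_nonneg (by positivity), one_div_pow]
  have hm := multipliable_one_add_of_summable hs
  simp only [← sub_eq_add_neg] at hm
  exact hm.hasProd.tendsto_prod_nat

theorem tprod_one_sub_inv_pow_mem_Icc {q : ℝ} (hq : 2 ≤ q) :
    ∏' i : ℕ, (1 - 1 / q ^ (i + 1)) ∈ Set.Icc (0 : ℝ) 1 :=
  isClosed_Icc.mem_of_tendsto (tendsto_prod_one_sub_inv_pow hq)
    (Filter.Eventually.of_forall fun N => prod_one_sub_inv_pow_mem_Icc (by linarith) N)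

theorem abs_prod_sub_tprod_le {q : ℝ} (hq : 2 ≤ q) (N : ℕ) :
    |∏ i ∈ Finset.range N, (1 - 1 / q ^ (i + 1)) - ∏' i : ℕ, (1 - 1 / q ^ (i + 1))|
      ≤ 1 / 2 ^ N := by
  set P : ℕ → ℝ := fun N => ∏ i ∈ Finset.range N, (1 - 1 / q ^ (i + 1)) with hP
  -- The factor at index j lowers the product by at most q^{-(j+1)} ≤ 2^{-(j+1)}; the bound is the
  -- partial geometric sum.
  have hstep : ∀ t, P (N + t) ≤ P N ∧ P N - 1 / 2 ^ N * (1 - 1 / 2 ^ t) ≤ P (N + t) := by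
    intro t
    induction t with
    | zero => simp
    | succ t ih =>
      have h1 : P (N + (t + 1)) = P (N + t) * (1 - 1 / q ^ (N + t + 1)) := by
        simp only [hP]
        rw [← add_assoc, Finset.prod_range_succ]
      have h2 := prod_one_sub_inv_pow_mem_Icc (q := q) (by linarith) (N + t)
      have h3 := one_sub_inv_pow_mem_Icc (q := q) (by linarith) (N + t)
      change P (N + t) ∈ _ at h2
      have h4 : 1 / q ^ (N + t + 1) ≤ 1 / 2 ^ (N + t + 1) := by gcongr
      have h5 : (0 : ℝ) < 1 / q ^ (N + t + 1) := by positivity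
      have h6 : (1 : ℝ) / 2 ^ (N + t + 1) = 1 / 2 ^ N * (1 / 2 ^ t) / 2 := by
        rw [pow_succ, pow_add]; field_simp
      have h7 : (1 : ℝ) / 2 ^ (t + 1) = 1 / 2 ^ t / 2 := by
        rw [pow_succ]; field_simp
      have h8 : P (N + t) * (1 / q ^ (N + t + 1)) ≤ 1 / q ^ (N + t + 1) :=
        mul_le_of_le_one_left h5.le h2.2
      have h9 : 0 ≤ P (N + t) * (1 / q ^ (N + t + 1)) := mul_nonneg h2.1 h5.le
      rw [h1, h7]
      constructor
      · nlinarith [ih.1]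
      · nlinarith [ih.2]
  have hlim : Filter.Tendsto (fun t => P (N + t)) Filter.atTop
      (nhds (∏' i : ℕ, (1 - 1 / q ^ (i + 1)))) := by
    have := (Filter.tendsto_add_atTop_iff_nat N).mpr (tendsto_prod_one_sub_inv_pow hq)
    simpa only [hP, add_comm N] using this
  have h1 : ∏' i : ℕ, (1 - 1 / q ^ (i + 1)) ≤ P N :=
    le_of_tendsto' hlim fun t => (hstep t).1
  have h2 : P N - 1 / 2 ^ N ≤ ∏' i : ℕ, (1 - 1 / q ^ (i + 1)) := by
    refine ge_of_tendsto' hlim fun t => le_trans ?_ (hstep t).2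
    have : (0 : ℝ) ≤ 1 / 2 ^ N * (1 / 2 ^ t) := by positivity
    linarith
  rw [abs_of_nonneg (by linarith)]
  linarith

end InfiniteProduct

/-! ### From random matrices to weights, and from divisibility to determinants -/

section Transfer

theorem measureReal_eq_sum {Ω γ : Type*} [MeasurableSpace Ω] [Fintype γ] (P : Measure Ω)
    [IsFiniteMeasure P] (f : Ω → γ) (hf : ∀ x, NullMeasurableSet {ω | f ω = x} P)
    (Q : γ → Prop) :
    P.real {ω | Q (f ω)} = mass (fun x => P.real {ω | f ω = x}) Q := by
  classical
  have h1 : {ω | Q (f ω)} = ⋃ x ∈ Finset.univ.filter Q, {ω | f ω = x} := by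
    ext ω
    simp
  rw [h1, measureReal_biUnion_finset₀]
  · rw [Finset.sum_filter, mass]
  · intro x _ y _ hxy
    refine Disjoint.aedisjoint ?_
    rw [Set.disjoint_left]
    rintro ω rfl h
    exact hxy h
  · exact fun x _ => hf x

theorem isWeight_measureReal {Ω γ : Type*} [MeasurableSpace Ω] [Fintype γ] (P : Measure Ω)
    [IsProbabilityMeasure P] (f : Ω → γ) (hf : ∀ x, NullMeasurableSet {ω | f ω = x} P) :
    IsWeight fun x => P.real {ω | f ω = x} where
  nonneg _ := measureReal_nonneg
  sum_eq_one := by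
    have := measureReal_eq_sum P f hf (fun _ => True)
    simpa [mass] using this.symm

variable {p n : ℕ} {Ω Ω' : Type*} [MeasurableSpace Ω] [MeasurableSpace Ω']
  {M : Ω → Matrix (Fin n) (Fin n) (ZMod p)} {P : Measure Ω} {ξ : Ω' → ZMod p} {P' : Measure Ω'}

/-- The transpose appears because A lists the columns of M. Null measurability suffices, since
identical distribution only gives a.e. measurable entries. -/
theorem HasIIDEntries.measureReal_eq_mass [NeZero p] [IsProbabilityMeasure P]
    [IsProbabilityMeasure P'] (hM : HasIIDEntries M P ξ P')
    (Q : Matrix (Fin n) (Fin n) (ZMod p) → Prop) :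
    P.real {ω | Q (M ω)} = mass (prodWeight (prodWeight fun a => P'.real {ω | ξ ω = a}))
      (fun A : Fin n → Fin n → ZMod p => Q (Matrix.of A).transpose) := by
  have hmeas : ∀ (i j : Fin n) (a : ZMod p), NullMeasurableSet {ω | M ω i j = a} P := by
    intro i j a
    exact (hM.identDistrib i j).aemeasurable_fst.nullMeasurableSet_preimage
      (MeasurableSet.singleton a)
  have hset : ∀ A : Fin n → Fin n → ZMod p, {ω | (Matrix.of.symm (M ω).transpose) = A}
      = ⋂ ij ∈ (Finset.univ : Finset (Fin n × Fin n)), {ω | M ω ij.1 ij.2 = A ij.2 ij.1} := by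
    intro A
    ext ω
    simp only [Set.mem_ofPred_eq, Finset.mem_univ, Set.iInter_true, Set.mem_iInter, Prod.forall]
    constructor
    · rintro rfl i j; rfl
    · intro h
      ext j i
      exact h i j
  have hnull : ∀ A : Fin n → Fin n → ZMod p,
      NullMeasurableSet {ω | (Matrix.of.symm (M ω).transpose) = A} P := by
    intro A
    rw [hset]
    exact Finset.nullMeasurableSet_biInter _ fun ij _ => hmeas _ _ _
  have hw : ∀ A : Fin n → Fin n → ZMod p, P.real {ω | (Matrix.of.symm (M ω).transpose) = A}
      = prodWeight (prodWeight fun a => P'.real {ω | ξ ω = a}) A := by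
    intro A
    have h1 := hM.indep.measure_inter_preimage_eq_mul Finset.univ
      (sets := fun ij => {A ij.2 ij.1}) (fun ij _ => MeasurableSet.singleton _)
    have h2 : ∀ ij : Fin n × Fin n, P ((fun ω => M ω ij.1 ij.2) ⁻¹' {A ij.2 ij.1})
        = P' {ω | ξ ω = A ij.2 ij.1} := fun ij =>
      (hM.identDistrib ij.1 ij.2).measure_mem_eq (MeasurableSet.singleton _)
    rw [Finset.prod_congr rfl fun ij _ => h2 ij] at h1
    rw [hset, measureReal_def]
    refine (congrArg ENNReal.toReal h1).trans ?_
    rw [ENNReal.toReal_prod, Fintype.prod_prod_type_right]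
    rfl
  have := measureReal_eq_sum P (fun ω => Matrix.of.symm (M ω).transpose) hnull
    (fun A => Q (Matrix.of A).transpose)
  simp only [hw] at this
  exact this

/-- Reduction modulo φ is a ring homomorphism sending x to the root, and it commutes with
determinants. -/
theorem dvd_detSubX_iff (φ : (ZMod p)[X]) (A : Fin n → Fin n → ZMod p) :
    φ ∣ detSubX (Matrix.of A).transpose ↔
      (Matrix.of fun j => (fun i => AdjoinRoot.of φ (A j i)) -
        (Pi.single j (AdjoinRoot.root φ) : Fin n → AdjoinRoot φ)).det = 0 := by
  rw [← AdjoinRoot.mk_eq_zero, detSubX, RingHom.map_det, ← Matrix.det_transpose]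
  apply iff_of_eq
  congr 2
  ext j i
  by_cases h : i = j <;> simp [h]

end Transfer

/-! ### Choice of parameters and size of the errors -/

section Asymptotics

/-- For large `n`, powers of `log n` are dominated by small powers of `n`. -/
theorem exists_threshold {α ε : ℝ} (hα : 0 < α) (hε : 0 < ε) :
    ∃ N₀ : ℕ, ∀ n : ℕ, N₀ ≤ n → 1 ≤ Real.log n ∧ -Real.log (α / 2) ≤ Real.log n ∧
      4 ≤ (n : ℝ) ^ (ε / 2) ∧ 44 * Real.log n ^ 3 + 1 ≤ α / 4 * (n : ℝ) ^ (ε / 2) := by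
  have hlog : Filter.Tendsto (fun n : ℕ => Real.log n) Filter.atTop Filter.atTop :=
    Real.tendsto_log_atTop.comp tendsto_natCast_atTop_atTop
  have hpow : Filter.Tendsto (fun n : ℕ => (n : ℝ) ^ (ε / 2)) Filter.atTop Filter.atTop :=
    (tendsto_rpow_atTop (by positivity)).comp tendsto_natCast_atTop_atTop
  have hlo := (isLittleO_log_rpow_rpow_atTop 3 (show 0 < ε / 2 by positivity)).comp_tendsto
    tendsto_natCast_atTop_atTop
  -- Half of the budget α/4 goes to 44 log³ n and the other half to the summand 1.
  have hlo' := hlo.def (show 0 < α / 8 / 44 by positivity)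
  have := (hlog.eventually_ge_atTop 1).and ((hlog.eventually_ge_atTop (-Real.log (α / 2))).and
    ((hpow.eventually_ge_atTop 4).and ((hpow.eventually_ge_atTop (8 / α)).and hlo')))
  obtain ⟨N₀, hN₀⟩ := Filter.eventually_atTop.mp this
  refine ⟨N₀, fun n hn => ?_⟩
  obtain ⟨h1, h2, h3, h4, h5⟩ := hN₀ n hn
  refine ⟨h1, h2, h3, ?_⟩
  simp only [Function.comp_apply, Real.norm_eq_abs] at h5
  have hL : 0 ≤ Real.log n := by linarith
  rw [abs_of_nonneg (by positivity), abs_of_nonneg (by positivity)] at h5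
  have h6 : Real.log n ^ (3 : ℝ) = Real.log n ^ 3 := by
    rw [← Real.rpow_natCast]; norm_num
  rw [h6] at h5
  rw [div_le_iff₀ hα] at h4
  linarith

set_option maxHeartbeats 1000000 in
/-- The total error is at most exponentially small. -/
theorem total_error_le {α ε b : ℝ} (hα : 0 < α) (hε : 0 < ε) (hε1 : ε < 1) (hb0 : 0 ≤ b)
    (hb : b ≤ 1 - α) {n p d m : ℕ} (hp : 2 ≤ p) (hpn : (p : ℝ) ≤ (n : ℝ) ^ ((1 - ε) / 2))
    (hd : (2 : ℝ) ^ d ≤ p) (h1 : 1 ≤ Real.log n) (h2 : -Real.log (α / 2) ≤ Real.log n)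
    (h3 : 4 ≤ (n : ℝ) ^ (ε / 2)) (h4 : 44 * Real.log n ^ 3 + 1 ≤ α / 4 * (n : ℝ) ^ (ε / 2))
    (hm : m = ⌈(n : ℝ) ^ (1 - ε / 2)⌉₊) :
    m ≤ n ∧
    2 * (((n : ℝ) + 1) ^ ((m + 1) * d) * ((p : ℝ) ^ d) ^ (d + (m + 1) * d + m)
        * (b * (1 + (p : ℝ) ^ d * Real.exp (-(α / (p : ℝ) ^ 2)) ^ (m + 1))) ^ (n - m))
      + n * b ^ m + n * Real.exp (-(α / (p : ℝ) ^ 2)) ^ (m + 1) + 1 / 2 ^ m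
      ≤ 5 * Real.exp (-((n : ℝ) ^ (1 - ε) / (p : ℝ) ^ 2)) := by
  set L := Real.log n with hL
  set T := (n : ℝ) ^ (ε / 2) with hT
  set x := (n : ℝ) ^ (1 - ε / 2) with hx
  set y := (n : ℝ) ^ (1 - ε) / (p : ℝ) ^ 2 with hy
  have hn2 : (1 : ℝ) < n := by
    by_contra hle
    push Not at hle
    have := Real.log_nonpos (Nat.cast_nonneg n) hle
    linarith
  have hn0 : (0 : ℝ) < n := by linarith
  have hp2 : (2 : ℝ) ≤ p := by exact_mod_cast hp
  have hp0 : (0 : ℝ) < (p : ℝ) ^ 2 := by positivity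
  have hp4 : (4 : ℝ) ≤ (p : ℝ) ^ 2 := by nlinarith
  have hxT : x * T = n := by
    rw [hx, hT, ← Real.rpow_add hn0]; simp
  have hxe : (n : ℝ) ^ (1 - ε) * T = x := by
    rw [hx, hT, ← Real.rpow_add hn0]; congr 1; ring
  have hx1 : 1 ≤ x := Real.one_le_rpow hn2.le (by linarith)
  have hmx : x ≤ m := by rw [hm]; exact Nat.le_ceil _
  have hm2x : (m : ℝ) ≤ 2 * x := by
    rw [hm]
    have := Nat.ceil_lt_add_one (show 0 ≤ x by linarith)
    linarith
  have hm1 : (1 : ℝ) ≤ m := hx1.trans hmx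
  have hmn2 : (m : ℝ) ≤ n / 2 := by
    linarith [mul_le_mul_of_nonneg_left h3 (show 0 ≤ x by linarith)]
  have hmn : m ≤ n := by
    have : (m : ℝ) ≤ n := by linarith
    exact_mod_cast this
  have hpe : (p : ℝ) ^ 2 ≤ (n : ℝ) ^ (1 - ε) := by
    calc (p : ℝ) ^ 2 ≤ ((n : ℝ) ^ ((1 - ε) / 2)) ^ 2 := by gcongr
      _ = (n : ℝ) ^ (1 - ε) := by
        rw [← Real.rpow_natCast, ← Real.rpow_mul hn0.le]; congr 1; push_cast; ring
  have hy1 : 1 ≤ y := by rw [hy, le_div_iff₀ hp0]; linarith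
  have hyn : y * 4 ≤ (n : ℝ) ^ (1 - ε) := by
    have : y * (p : ℝ) ^ 2 = (n : ℝ) ^ (1 - ε) := by rw [hy]; field_simp
    rw [← this]
    gcongr
  have hnx : (n : ℝ) ^ (1 - ε) ≤ x := by
    rw [← hxe]
    exact le_mul_of_one_le_right (by positivity) (by linarith)
  -- The exponent 1 - ε/2 in m leaves a spare factor T = n^(ε/2) over the target y, which absorbs
  -- all logarithmic losses.
  have hmy : T * y ≤ m / (p : ℝ) ^ 2 := by
    rw [hy, ← mul_div_assoc, mul_comm T, hxe]
    gcongr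
  have hL0 : 0 ≤ L := by linarith
  have hL2 : L ≤ L ^ 2 := by nlinarith
  have hL3 : L ^ 2 ≤ L ^ 3 := by
    have : 0 ≤ L ^ 2 * (L - 1) := mul_nonneg (by positivity) (by linarith)
    nlinarith
  have hnexp : (n : ℝ) = Real.exp L := (Real.exp_log hn0).symm
  have hpL : Real.log p ≤ L := by
    refine Real.log_le_log (by linarith) (hpn.trans ?_)
    calc (n : ℝ) ^ ((1 - ε) / 2) ≤ (n : ℝ) ^ (1 : ℝ) :=
          Real.rpow_le_rpow_of_exponent_le hn2.le (by linarith)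
      _ = n := Real.rpow_one _
  -- This is where 2^d ≤ p ≤ n enters, together with log 2 > 1/2.
  have hdL : (d : ℝ) ≤ 2 * L := by
    have h5 := Real.log_le_log (by positivity) hd
    rw [Real.log_pow] at h5
    have h6 := Real.log_two_gt_d9
    have h7 : (d : ℝ) * (1 / 2) ≤ d * Real.log 2 := by gcongr; linarith
    linarith
  have hd0 : (0 : ℝ) ≤ d := Nat.cast_nonneg d
  have hq : (p : ℝ) ^ d ≤ Real.exp (2 * L ^ 2) := by
    have : (p : ℝ) ^ d = Real.exp (d * Real.log p) := by
      rw [Real.exp_nat_mul, Real.exp_log (by linarith)]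
    rw [this]
    apply Real.exp_le_exp.mpr
    calc (d : ℝ) * Real.log p ≤ 2 * L * L := by
          have : 0 ≤ Real.log p := Real.log_nonneg (by linarith)
          gcongr
      _ = 2 * L ^ 2 := by ring
  -- exponentially small powers of the Fourier decay rate
  set g := Real.exp (-(α / (p : ℝ) ^ 2)) with hg
  have hgm : ∀ j : ℕ, (m : ℝ) ≤ j → g ^ j ≤ Real.exp (-(α * (T * y))) := by
    intro j hj
    rw [hg, ← Real.exp_nat_mul]
    apply Real.exp_le_exp.mpr
    have : (m : ℝ) / (p : ℝ) ^ 2 ≤ j / (p : ℝ) ^ 2 := by gcongr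
    have h5 : T * y ≤ j / (p : ℝ) ^ 2 := hmy.trans this
    have h6 := mul_le_mul_of_nonneg_left h5 hα.le
    have h7 : (j : ℝ) * -(α / (p : ℝ) ^ 2) = -(α * (j / (p : ℝ) ^ 2)) := by ring
    rw [h7]
    linarith
  have hαT : L + 1 ≤ α * T := by linarith [pow_nonneg hL0 3]
  have hngm : ∀ j : ℕ, (m : ℝ) ≤ j → n * g ^ j ≤ Real.exp (-y) := by
    intro j hj
    calc (n : ℝ) * g ^ j ≤ Real.exp L * Real.exp (-(α * (T * y))) := by
          rw [← hnexp]; exact mul_le_mul_of_nonneg_left (hgm j hj) hn0.le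
      _ = Real.exp (L - α * T * y) := by rw [← Real.exp_add]; congr 1; ring
      _ ≤ Real.exp (-y) := by
          apply Real.exp_le_exp.mpr
          have h5 := mul_le_mul_of_nonneg_right hαT (show 0 ≤ y by linarith)
          have h6 : L ≤ L * y := le_mul_of_one_le_right hL0 hy1
          linarith
  have hbg : b ≤ g := by
    refine hb.trans ?_
    have h5 := Real.add_one_le_exp (-(α / (p : ℝ) ^ 2))
    have h6 : α / (p : ℝ) ^ 2 ≤ α := div_le_self hα.le (by linarith)
    rw [hg]
    linarith
  have hB : n * b ^ m ≤ Real.exp (-y) := by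
    refine le_trans ?_ (hngm m le_rfl)
    gcongr
  have hGm := hngm (m + 1) (by push_cast; linarith)
  have h2m : (1 : ℝ) / 2 ^ m ≤ Real.exp (-y) := by
    have h5 : (2 : ℝ) ^ m = Real.exp (m * Real.log 2) := by
      rw [Real.exp_nat_mul, Real.exp_log (by norm_num)]
    rw [h5, one_div, ← Real.exp_neg]
    apply Real.exp_le_exp.mpr
    have h6 := Real.log_two_gt_d9
    have h7 : (m : ℝ) * (1 / 2) ≤ m * Real.log 2 := by gcongr; linarith
    linarith
  -- sparse eigenvectors
  have hqg : (p : ℝ) ^ d * g ^ (m + 1) ≤ α / 2 := by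
    calc (p : ℝ) ^ d * g ^ (m + 1)
        ≤ Real.exp (2 * L ^ 2) * Real.exp (-(α * (T * y))) := by
          have := hgm (m + 1) (by push_cast; linarith)
          gcongr
      _ = Real.exp (2 * L ^ 2 - α * T * y) := by rw [← Real.exp_add]; congr 1; ring
      _ ≤ Real.exp (Real.log (α / 2)) := by
          apply Real.exp_le_exp.mpr
          have h5 : α * T ≤ α * T * y := le_mul_of_one_le_right (by positivity) hy1
          linarith
      _ = α / 2 := Real.exp_log (by positivity)
  -- The Fourier error spoils at most half of the gain in b ≤ 1 - α ≤ exp(-α).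
  have hbase : b * (1 + (p : ℝ) ^ d * g ^ (m + 1)) ≤ Real.exp (-(α / 2)) := by
    calc b * (1 + (p : ℝ) ^ d * g ^ (m + 1)) ≤ Real.exp (-α) * Real.exp (α / 2) := by
          have h5 := Real.add_one_le_exp (-α)
          have h6 := Real.add_one_le_exp (α / 2)
          refine mul_le_mul (by linarith) (by linarith) (by positivity) (Real.exp_pos _).le
      _ = _ := by rw [← Real.exp_add]; congr 1; ring
  have hpow : (b * (1 + (p : ℝ) ^ d * g ^ (m + 1))) ^ (n - m) ≤ Real.exp (-(α * n / 4)) := by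
    calc _ ≤ Real.exp (-(α / 2)) ^ (n - m) := pow_le_pow_left₀ (by positivity) hbase _
      _ = Real.exp (((n - m : ℕ) : ℝ) * -(α / 2)) := (Real.exp_nat_mul _ _).symm
      _ ≤ _ := by
          apply Real.exp_le_exp.mpr
          rw [Nat.cast_sub hmn]
          linarith [mul_le_mul_of_nonneg_left hmn2 hα.le]
  have hn1 : (n : ℝ) + 1 ≤ Real.exp (2 * L) := by
    have : Real.exp (2 * L) = (n : ℝ) * n := by rw [two_mul, Real.exp_add, ← hnexp]
    rw [this]
    have hn2' : (2 : ℝ) ≤ n := by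
      have : 1 < n := by exact_mod_cast hn2
      exact_mod_cast this
    nlinarith
  have hpre1 : ((n : ℝ) + 1) ^ ((m + 1) * d) ≤ Real.exp (8 * m * L ^ 2) := by
    calc _ ≤ Real.exp (2 * L) ^ ((m + 1) * d) := pow_le_pow_left₀ (by positivity) hn1 _
      _ = Real.exp ((((m + 1) * d : ℕ) : ℝ) * (2 * L)) := (Real.exp_nat_mul _ _).symm
      _ ≤ _ := by
          apply Real.exp_le_exp.mpr
          push_cast
          calc ((m : ℝ) + 1) * d * (2 * L) ≤ (2 * m) * (2 * L) * (2 * L) := by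
                gcongr; linarith
            _ = _ := by ring
  have hpre2 : ((p : ℝ) ^ d) ^ (d + (m + 1) * d + m) ≤ Real.exp (14 * m * L ^ 3) := by
    calc _ ≤ Real.exp (2 * L ^ 2) ^ (d + (m + 1) * d + m) :=
          pow_le_pow_left₀ (by positivity) hq _
      _ = Real.exp (((d + (m + 1) * d + m : ℕ) : ℝ) * (2 * L ^ 2)) := (Real.exp_nat_mul _ _).symm
      _ ≤ _ := by
          apply Real.exp_le_exp.mpr
          push_cast
          have h5 : (d : ℝ) + (m + 1) * d + m ≤ 7 * m * L := by
            have h6 : ((m : ℝ) + 1) * d ≤ (2 * m) * (2 * L) := by gcongr; linarith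
            have h7 : (m : ℝ) ≤ m * L := le_mul_of_one_le_right (by linarith) h1
            have h8 : L ≤ m * L := le_mul_of_one_le_left hL0 hm1
            linarith
          calc ((d : ℝ) + (m + 1) * d + m) * (2 * L ^ 2) ≤ 7 * m * L * (2 * L ^ 2) := by gcongr
            _ = _ := by ring
  have hD : ((n : ℝ) + 1) ^ ((m + 1) * d) * ((p : ℝ) ^ d) ^ (d + (m + 1) * d + m)
        * (b * (1 + (p : ℝ) ^ d * g ^ (m + 1))) ^ (n - m) ≤ Real.exp (-y) := by
    calc _ ≤ Real.exp (8 * m * L ^ 2) * Real.exp (14 * m * L ^ 3) * Real.exp (-(α * n / 4)) := by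
          gcongr
      _ = Real.exp (8 * m * L ^ 2 + 14 * m * L ^ 3 - α * n / 4) := by
          rw [← Real.exp_add, ← Real.exp_add]; congr 1
      _ ≤ Real.exp (-y) := by
          apply Real.exp_le_exp.mpr
          -- Here 44 = 2(8 + 14), from m ≤ 2x. The threshold inequality times x then leaves a
          -- surplus x ≥ y.
          have h5 : 8 * m * L ^ 2 + 14 * m * L ^ 3 ≤ 44 * L ^ 3 * x := by
            have h6 : 8 * m * L ^ 2 ≤ 8 * m * L ^ 3 := by gcongr
            have h7 : (m : ℝ) * L ^ 3 ≤ 2 * x * L ^ 3 := by gcongr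
            linarith
          have h8 := mul_le_mul_of_nonneg_right h4 (show 0 ≤ x by linarith)
          have h9 : α / 4 * T * x = α * n / 4 := by rw [← hxT]; ring
          rw [h9] at h8
          linarith
  exact ⟨hmn, by linarith⟩

end Asymptotics

/-! ### Assembling the estimates -/

theorem theorem1p5 :
    ∃ C₀ : ℕ → ℝ, ∀ α ε : ℝ, 0 < α → 0 < ε → ε < 1 →
      ∃ c K : ℝ, 0 < c ∧ 0 < K ∧
        ∀ (p n : ℕ), p.Prime → (p : ℝ) ≤ (n : ℝ) ^ ((1 - ε) / 2) →
        ∀ φ : (ZMod p)[X], Irreducible φ → C₀ φ.natDegree ≤ (p : ℝ) →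
        ∀ (Ω Ω' : Type*) [MeasurableSpace Ω] [MeasurableSpace Ω']
          (P : Measure Ω) (P' : Measure Ω') [IsProbabilityMeasure P] [IsProbabilityMeasure P']
          (ξ : Ω' → ZMod p) (M : Ω → Matrix (Fin n) (Fin n) (ZMod p)),
          IsBalanced α ξ P' → HasIIDEntries M P ξ P' →
          |P.real {ω | φ ∣ detSubX (M ω)}
              - (1 - ∏' i : ℕ, (1 - ((p : ℝ) ^ ((i + 1) * φ.natDegree))⁻¹))|
            ≤ K * Real.exp (-(c * (n : ℝ) ^ (1 - ε) / (p : ℝ) ^ 2)) := by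
  -- C₀(d) = 2^d serves only to make d logarithmic in p, hence in n.
  refine ⟨fun d => 2 ^ d, fun α ε hα hε hε1 => ?_⟩
  obtain ⟨N₀, hN₀⟩ := exists_threshold hα hε
  -- The 5 collects the error terms for n ≥ N₀. For n < N₀ the exponent is at most N₀ and the
  -- difference at most 1, so exp(N₀) makes the bound trivial.
  refine ⟨1, max 5 (Real.exp N₀), one_pos, lt_max_of_lt_left (by norm_num), ?_⟩
  intro p n hp hpn φ hφ hd Ω Ω' _ _ P P' _ _ ξ M hξ hM
  have : Fact p.Prime := ⟨hp⟩
  have : Fact (Irreducible φ) := ⟨hφ⟩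
  set d := φ.natDegree with hdd
  have hp2 : (2 : ℝ) ≤ p := by exact_mod_cast hp.two_le
  have hd1 : 1 ≤ d := hφ.natDegree_pos
  have hq2 : (2 : ℝ) ≤ (p : ℝ) ^ d := hp2.trans (le_self_pow₀ (by linarith) (by omega))
  have hprod : ∏' i : ℕ, (1 - ((p : ℝ) ^ ((i + 1) * d))⁻¹)
      = ∏' i : ℕ, (1 - 1 / ((p : ℝ) ^ d) ^ (i + 1)) := by
    refine tprod_congr fun i => ?_
    rw [← pow_mul, mul_comm d, one_div]
  rw [hprod, one_mul]
  have hn1 : 1 ≤ n := by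
    rcases Nat.eq_zero_or_pos n with rfl | h
    · rw [Nat.cast_zero, Real.zero_rpow (by linarith)] at hpn
      linarith
    · exact h
  have hn1' : (1 : ℝ) ≤ n := by exact_mod_cast hn1
  rcases lt_or_ge n N₀ with hlt | hge
  · have h1 := tprod_one_sub_inv_pow_mem_Icc hq2
    have h2 : P.real {ω | φ ∣ detSubX (M ω)} ∈ Set.Icc (0 : ℝ) 1 :=
      ⟨measureReal_nonneg, measureReal_le_one⟩
    have h3 : (n : ℝ) ^ (1 - ε) / (p : ℝ) ^ 2 ≤ N₀ := by
      calc (n : ℝ) ^ (1 - ε) / (p : ℝ) ^ 2 ≤ (n : ℝ) ^ (1 - ε) :=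
            div_le_self (by positivity) (one_le_pow₀ (by linarith))
        _ ≤ (n : ℝ) ^ (1 : ℝ) := Real.rpow_le_rpow_of_exponent_le hn1' (by linarith)
        _ = n := Real.rpow_one _
        _ ≤ N₀ := by exact_mod_cast hlt.le
    calc _ ≤ (1 : ℝ) := by
          rw [abs_le]
          constructor <;> linarith [h1.1, h1.2, h2.1, h2.2]
      _ = Real.exp N₀ * Real.exp (-N₀) := by rw [← Real.exp_add]; simp
      _ ≤ _ := by
          gcongr
          exact le_max_right _ _
  · obtain ⟨h1, h2, h3, h4⟩ := hN₀ n hge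
    -- the weight of one entry
    set μ : ZMod p → ℝ := fun a => P'.real {ω | ξ ω = a} with hμdef
    have hμ : IsWeight μ := by
      refine isWeight_measureReal P' ξ fun a => ?_
      exact (hM.identDistrib ⟨0, hn1⟩ ⟨0, hn1⟩).aemeasurable_snd.nullMeasurableSet_preimage
        (MeasurableSet.singleton a)
    have hb : ∀ a, μ a ≤ 1 - α := hξ
    have hb0 : 0 ≤ 1 - α := (hμ.nonneg 0).trans (hb 0)
    have hg := hμ.norm_charFun_le hb
    have hg1 : Real.exp (-(α / (p : ℝ) ^ 2)) ≤ 1 := by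
      rw [Real.exp_le_one_iff]
      have : 0 ≤ α / (p : ℝ) ^ 2 := by positivity
      linarith
    -- the field `𝔽_p[x] / φ`
    let E := AdjoinRoot φ
    let pb := AdjoinRoot.powerBasis hφ.ne_zero
    have hfin : Module.Finite (ZMod p) E := pb.finite
    have : Finite E := Module.finite_of_finite (ZMod p)
    let _ : Fintype E := Fintype.ofFinite E
    have hrank : Module.finrank (ZMod p) E = d := by
      rw [pb.finrank, AdjoinRoot.powerBasis_dim]
    have hcard : Fintype.card E = p ^ d := by
      rw [Module.card_eq_pow_finrank (K := ZMod p), hrank, ZMod.card]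
    have hcardR : (Fintype.card E : ℝ) = (p : ℝ) ^ d := by rw [hcard]; push_cast; rfl
    have : Nontrivial (AddChar E ℂ) := by
      rw [← Fintype.one_lt_card_iff_nontrivial, AddChar.card_eq]
      exact Fintype.one_lt_card
    obtain ⟨χ, hχ⟩ := exists_ne (1 : AddChar E ℂ)
    have hlam : Algebra.adjoin (ZMod p) {AdjoinRoot.root φ} = ⊤ := AdjoinRoot.adjoinRoot_eq_top
    obtain ⟨hmn, herr⟩ := total_error_le hα hε hε1 hb0 le_rfl hp.two_le hpn hd h1 h2 h3 h4 rfl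
    set m := ⌈(n : ℝ) ^ (1 - ε / 2)⌉₊ with hm
    set J := Finset.univ.filter fun j : Fin n => (j : ℕ) < n - m with hJ
    have hJc : J.card = n - m := by
      rw [hJ, Fin.card_filter_val_lt]
      omega
    have hJc' : Jᶜ.card = m := by
      rw [Finset.card_compl, hJc, Fintype.card_fin]
      omega
    -- r = m + 1 is the least value exceeding the number m of columns missing from J.
    have hbad := mass_exists_isSparseEigenvector_le hμ hb (Real.exp_pos _).le hg1 hg hχ hlam
      (J := J) (r := m + 1) (by omega)
    rw [hrank, hcardR, hJc, hJc', Fintype.card_fin] at hbad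
    have hmain := abs_mass_finrank_initSpan_eq_sub_le hμ hb (by linarith) (Real.exp_pos _).le hg1 hg
      hχ (lam := AdjoinRoot.root φ) (Nat.sub_le n m) hbad
    rw [hcardR, show n - (n - m) = m by omega] at hmain
    have htail := abs_prod_sub_tprod_le hq2 m
    have hprob : P.real {ω | φ ∣ detSubX (M ω)} = 1 - mass (prodWeight (prodWeight μ))
        (fun A : Fin n → Fin n → ZMod p => Module.finrank E
          (initSpan E (shiftedColumn (AdjoinRoot.root φ) A) n) = n) := by
      rw [hM.measureReal_eq_mass (fun B => φ ∣ detSubX B),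
        ← mass_compl hμ.prodWeight.prodWeight]
      congr 1
      ext A
      rw [dvd_detSubX_iff, finrank_initSpan_eq_iff_det, not_not]
      rfl
    rw [hprob]
    have h5 : 5 * Real.exp (-((n : ℝ) ^ (1 - ε) / (p : ℝ) ^ 2))
        ≤ max 5 (Real.exp N₀) * Real.exp (-((n : ℝ) ^ (1 - ε) / (p : ℝ) ^ 2)) := by
      gcongr
      exact le_max_left _ _
    refine le_trans ?_ h5
    rw [abs_le] at hmain htail ⊢
    constructor <;> linarith [hmain.1, hmain.2, htail.1, htail.2]
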